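/- Let $W$ be a binary-input memoryless channel with input alphabet $\{0,1\}$, output alphabet $\mathcal Y$ and transition probabilities $W(y|x)$ (or, more generally, transition densities with respect to a $\sigma$-finite measure on $\mathcal Y$; sums over $\mathcal Y$ are then integrals). Let $$I(W)=\sum_{y\in\mathcal Y}\sum_{x\in\{0,1\}}\tfrac12 W(y|x)\log_2\frac{W(y|x)}{\frac12W(y|0)+\frac12W(y|1)}$$ be its symmetric capacity. For $N=2^n$ let $G_N=F^{\otimes n}$ over $\mathbb F_2$, where $F=\begin{pmatrix}1&0\\1&1\end{pmatrix}$. A polar code of block length $N$ is given by a set $A\subseteq\{1,\dots,N\}$ of information indices and fixed values $(f_i)_{i\notin A}$ in $\{0,1\}$; it encodes $u\in\{0,1\}^N$ with $u_i=f_i$ for $i\notin A$ as $x=uG_N$, which is sent over $N$ independent uses of $W$. The successive-cancellation decoder computes, for $i=1,\dots,N$ in this order, $\hat u_i=f_i$ if $i\notin A$, and if $i\in A$ the value $b\in\{0,1\}$ that maximizes $$W_N^{(i)}(y,\hat u_1,\dots,\hat u_{i-1}\,|\,b)=\sum_{v\in\{0,1\}^N:\ v_j=\hat u_j\,(j<i),\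 v_i=b}\frac1{2^{N-1}}\prod_{j=1}^N W\bigl(y_j\,|\,(vG_N)_j\bigr),$$ with ties resolved to $0$. The block error probability of the code is the probability that $\hat u\neq u$ when $(u_i)_{i\in A}$ is uniformly distributed, and $P_e(N,R)$ denotes the least block error probability among all polar codes of block length $N$ with $|A|=\lceil NR\rceil$. Theorem. Suppose $I(W)>0$ and let $R\in(0,I(W))$ be fixed. Then, for every real $t<Q^{-1}(R/I(W))$, where $Q(x)=\int_x^\infty e^{-u^2/2}\,du/\sqrt{2\pi}$, $$P_e(2^n,R)=o\left(2^{-2^{(n+t\sqrt n)/2}}\right)\qquad(n\to\infty).$$ -/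

import Mathlib

open MeasureTheory Filter Asymptotics

noncomputable section

/-- A binary-input memoryless channel with input alphabet `{0, 1} = ZMod 2` and output alphabet
`Y`. The transition probabilities `W(y|x) = W.p x y` are given with respect to a reference measure
`μ` on `Y`: for a discrete (finite or countable) alphabet `μ` is the counting measure, integrals
over `μ` are sums over `Y` and `p x y` is the probability of the output `y` under the input `x`;
for a continuous alphabet `p x` is the density of the output under the input `x`. -/
structure BinaryInputChannel (Y : Type*) [MeasurableSpace Y] (μ : Measure Y) where
  p : ZMod 2 → Y → ℝ
  measurable_p : ∀ x, Measurable (p x)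
  nonneg : ∀ x y, 0 ≤ p x y
  lintegral_eq_one : ∀ x, ∫⁻ y, ENNReal.ofReal (p x y) ∂μ = 1

/-- The kernel `F` of the polar transform, with rows `(1, 0)` and `(1, 1)`. -/
def polarKernel : Matrix (Fin 2) (Fin 2) (ZMod 2) := !![1, 0; 1, 1]

/-- The `n`-fold Kronecker power of `F`, with rows and columns in lexicographic order:
the pair `(a, b)` has the index `2 * a + b`. -/
def polarMatrix : (n : ℕ) → Matrix (Fin (2 ^ n)) (Fin (2 ^ n)) (ZMod 2)
  | 0 => 1
  | n + 1 =>
    let e : Fin (2 ^ n) × Fin 2 ≃ Fin (2 ^ (n + 1)) :=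
      finProdFinEquiv.trans (finCongr (pow_succ 2 n).symm)
    Matrix.reindex e e (Matrix.kronecker (polarMatrix n) polarKernel)

/-- A polar code of block length `2 ^ n`: the set of indices that carry data, and the
predetermined values sent at the other indices (`frozen` is used outside `infoSet` only). -/
structure PolarCode (n : ℕ) where
  infoSet : Finset (Fin (2 ^ n))
  frozen : Fin (2 ^ n) → ZMod 2

namespace BinaryInputChannel

variable {Y : Type*} [MeasurableSpace Y] {μ : Measure Y}

/-- The symmetric capacity in bits: the mutual information between input and output when the
input is uniformly distributed. -/
def symmetricCapacity (W : BinaryInputChannel Y μ) : ℝ :=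
  ∫ y, ∑ x : ZMod 2, 1 / 2 * W.p x y *
    Real.logb 2 (W.p x y / (1 / 2 * W.p 0 y + 1 / 2 * W.p 1 y)) ∂μ

/-- The law on `Y` of the output of the channel under the input `x`. -/
def outputLaw (W : BinaryInputChannel Y μ) (x : ZMod 2) : Measure Y :=
  μ.withDensity fun y => ENNReal.ofReal (W.p x y)

/-- The law of the output block when the word `x` is sent by independent uses of the channel. -/
def blockLaw (W : BinaryInputChannel Y μ) {n : ℕ} (x : Fin (2 ^ n) → ZMod 2) :
    Measure (Fin (2 ^ n) → Y) :=
  Measure.pi fun j => W.outputLaw (x j)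

/-- The transition probability `W_N^(i)(y, u_0, …, u_{i-1} | b)` of the `i`-th of the `N = 2 ^ n`
channels obtained by combining and splitting `N` copies of `W`: the inputs after the `i`-th are
uniform, the inputs before it (`past`) belong to the output. -/
def splitProb (W : BinaryInputChannel Y μ) {n : ℕ} (y : Fin (2 ^ n) → Y) (i : Fin (2 ^ n))
    (past : (j : Fin (2 ^ n)) → j < i → ZMod 2) (b : ZMod 2) : ℝ :=
  ∑ v : Fin (2 ^ n) → ZMod 2 with (∀ (j : Fin (2 ^ n)) (h : j < i), v j = past j h) ∧ v i = b,
    1 / 2 ^ (2 ^ n - 1) * ∏ j, W.p (Matrix.vecMul v (polarMatrix n) j) (y j)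

/-- The successive-cancellation decoder: the bits are estimated in increasing order; a frozen bit
is known, an information bit is decided by maximum likelihood for its split channel, given the
output block and the earlier estimates (and set to `0` in case of a tie). -/
def scDecode (W : BinaryInputChannel Y μ) {n : ℕ} (c : PolarCode n) (y : Fin (2 ^ n) → Y)
    (i : Fin (2 ^ n)) : ZMod 2 :=
  if i ∈ c.infoSet then
    if W.splitProb y i (fun j _ => W.scDecode c y j) 1 ≤
        W.splitProb y i (fun j _ => W.scDecode c y j) 0 then 0 else 1
  else c.frozen i
termination_by i

/-- The block error probability of a polar code under successive-cancellation decoding, for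
uniformly distributed data. -/
def blockErrorProb (W : BinaryInputChannel Y μ) {n : ℕ} (c : PolarCode n) : ℝ :=
  1 / 2 ^ c.infoSet.card *
    ∑ u : Fin (2 ^ n) → ZMod 2 with ∀ i ∉ c.infoSet, u i = c.frozen i,
      (W.blockLaw (Matrix.vecMul u (polarMatrix n))).real {y | W.scDecode c y ≠ u}

/-- `P_e(2 ^ n, R)`: the least block error probability among the polar codes of block length
`2 ^ n` that have `⌈2 ^ n * R⌉` information indices (such codes exist for `R ≤ 1`). -/
def bestBlockErrorProb (W : BinaryInputChannel Y μ) (n : ℕ) (R : ℝ) : ℝ :=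
  ⨅ c : {c : PolarCode n // c.infoSet.card = ⌈(2 : ℝ) ^ n * R⌉₊}, W.blockErrorProb c.1

end BinaryInputChannel

/-- The tail function of the standard Gaussian distribution. -/
def gaussianQ (x : ℝ) : ℝ :=
  ∫ u in Set.Ioi x, Real.exp (-u ^ 2 / 2) / Real.sqrt (2 * Real.pi)

/-- The inverse of the bijection `gaussianQ` from `ℝ` onto the open unit interval
(used on that interval only). -/
def gaussianQInv : ℝ → ℝ := Function.invFun gaussianQ

end

/-!
The proof follows the split channels of the polar transform through the law of the posterior
probability of their input bit, a probability measure `D` on the unit interval. One step of the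
transform replaces `D` by `minusLaw D` or `plusLaw D`, and `sum_lintegral_posterior` shows that the
`i`-th split channel of block length `2 ^ n` has the law obtained from that of `W` along the binary
digits of `i`. All channel parameters are integrals with respect to `D`: the Bhattacharyya
parameter `Z = ∫ 2 √(a (1 - a))` satisfies `Z⁺ = Z²` and `Z⁻ ≤ 2 Z - Z²`, the conditional entropy
satisfies the chain rule `H⁻ + H⁺ = 2 H`, and the capacity is `1 - H`.

*Polarization.* Along uniformly random digits `Z` is a bounded supermartingale, so its increments
are square summable in mean. Half of the increments are `Z² - Z`, hence `Z (1 - Z)` tends to zero in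
mean square. As `1 - H` is small when `Z` is close to one and the mean of `H` is conserved, for
every `ε` the fraction of the channels with `Z ≤ ε` after some fixed number `m` of steps is almost
the capacity (`exists_bitAverage_bhattacharyya_le`).

*Speed.* From a channel with `Z ≤ 2 ^ (-K)`, the exponent `-log₂ Z` doubles with every plus step and
loses at most one with every minus step. After a path with `S` plus steps it is therefore at least
`2 ^ S (K - X)`, where `X` charges `2 ^ (-k)` for a minus step that follows `k` plus steps. The mean
of `X` is at most `2` for every length of the path, so by Markov's inequality `2 ^ S` is a lower
bound up to a fraction of order `1 / K` of the paths. By the central limit theorem `S` exceeds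
`(n + t √n) / 2` with a probability that tends to `Q(t)`; the `m` steps spent before do not matter
on the scale `√n`. This gives `eventually_le_bitAverage`: asymptotically, a fraction of at least
`I(W) Q(t)` of the channels has `Z ≤ 2 ^ (-2 ^ ((n + t √n) / 2))`.

*Decoding.* Averaged over the frozen values, the block error probability is at most the sum of the
Bhattacharyya parameters of the information indices (`exists_blockErrorProb_le`). The factor
`2 ^ n` of this union bound is absorbed by increasing `t` slightly.
-/

noncomputable section

local notation "𝕀" => unitInterval

/-! ### Averages over bit strings -/

/-- The average of `g` over the `2 ^ n` bit strings of length `n`. -/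
def bitAverage : ℕ → (List Bool → ℝ) → ℝ
  | 0, g => g []
  | n + 1, g => (bitAverage n (fun w => g (false :: w)) + bitAverage n (fun w => g (true :: w))) / 2

lemma bitAverage_add (n : ℕ) (f g : List Bool → ℝ) :
    bitAverage n (fun w => f w + g w) = bitAverage n f + bitAverage n g := by
  induction n generalizing f g with
  | zero => rfl
  | succ n ih => simp only [bitAverage, ih]; ring

lemma bitAverage_const_mul (n : ℕ) (c : ℝ) (g : List Bool → ℝ) :
    bitAverage n (fun w => c * g w) = c * bitAverage n g := by
  induction n generalizing g with
  | zero => rfl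
  | succ n ih => simp only [bitAverage, ih]; ring

@[simp]
lemma bitAverage_const (n : ℕ) (c : ℝ) : bitAverage n (fun _ => c) = c := by
  induction n with
  | zero => rfl
  | succ n ih => simp only [bitAverage, ih]; ring

lemma bitAverage_mono (n : ℕ) {f g : List Bool → ℝ} (h : ∀ w, w.length = n → f w ≤ g w) :
    bitAverage n f ≤ bitAverage n g := by
  induction n generalizing f g with
  | zero => exact h [] rfl
  | succ n ih =>
    have h1 := ih (f := fun w => f (false :: w)) (g := fun w => g (false :: w))
      fun w hw => h _ (by simp [hw])
    have h2 := ih (f := fun w => f (true :: w)) (g := fun w => g (true :: w))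
      fun w hw => h _ (by simp [hw])
    simp only [bitAverage]
    linarith

lemma bitAverage_nonneg (n : ℕ) {g : List Bool → ℝ} (h : ∀ w, 0 ≤ g w) : 0 ≤ bitAverage n g := by
  simpa using bitAverage_mono n (f := fun _ => 0) (g := g) fun w _ => h w

lemma bitAverage_append (m n : ℕ) (g : List Bool → ℝ) :
    bitAverage (m + n) g = bitAverage m (fun v => bitAverage n (fun w => g (v ++ w))) := by
  induction m generalizing g with
  | zero => simp [bitAverage]
  | succ m ih =>
    rw [show m + 1 + n = (m + n) + 1 by omega]
    simp only [bitAverage, ih, List.cons_append]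

lemma bitAverage_succ_last (n : ℕ) (g : List Bool → ℝ) :
    bitAverage (n + 1) g =
      bitAverage n (fun v => (g (v ++ [false]) + g (v ++ [true])) / 2) := by
  rw [bitAverage_append]
  rfl

/-! ### The central limit theorem for the number of ones -/

/-- The law of a simple random walk on the line after `n` steps of size one. -/
def walkLaw : ℕ → Measure ℝ
  | 0 => Measure.dirac 0
  | n + 1 => (2⁻¹ : NNReal) • (walkLaw n).map (· + -1) + (2⁻¹ : NNReal) • (walkLaw n).map (· + 1)

instance isProbabilityMeasure_walkLaw (n : ℕ) : IsProbabilityMeasure (walkLaw n) := by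
  induction n with
  | zero => rw [walkLaw]; infer_instance
  | succ n ih =>
    constructor
    have h1 : (walkLaw n).map (· + (-1 : ℝ)) Set.univ = 1 := by
      rw [Measure.map_apply (by fun_prop) MeasurableSet.univ]; simp
    have h2 : (walkLaw n).map (· + (1 : ℝ)) Set.univ = 1 := by
      rw [Measure.map_apply (by fun_prop) MeasurableSet.univ]; simp
    simp only [walkLaw, Measure.add_apply, Measure.smul_apply, h1, h2]
    simp [ENNReal.smul_def, ENNReal.inv_two_add_inv_two]

lemma charFun_walkLaw (n : ℕ) (t : ℝ) : charFun (walkLaw n) t = (Real.cos t : ℂ) ^ n := by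
  induction n with
  | zero => simp [walkLaw]
  | succ n ih =>
    have key : ∀ c : ℝ, charFun ((walkLaw n).map (· + c)) t
        = charFun (walkLaw n) t * Complex.exp (t * c * Complex.I) := by
      intro c
      rw [charFun_map_add_const, mul_comm]
      simp [mul_comm]
    have hs : ∀ (m : Measure ℝ), charFun ((2⁻¹ : NNReal) • m) t = (2⁻¹ : ℂ) * charFun m t := by
      intro m
      simp [charFun_apply, integral_smul_nnreal_measure, NNReal.smul_def]
    have hadd : charFun (walkLaw (n + 1)) t =
        charFun ((2⁻¹ : NNReal) • (walkLaw n).map (· + (-1 : ℝ))) t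
          + charFun ((2⁻¹ : NNReal) • (walkLaw n).map (· + (1 : ℝ))) t := by
      have : IsProbabilityMeasure ((walkLaw n).map (· + (-1 : ℝ))) :=
        Measure.isProbabilityMeasure_map (by fun_prop)
      have : IsProbabilityMeasure ((walkLaw n).map (· + (1 : ℝ))) :=
        Measure.isProbabilityMeasure_map (by fun_prop)
      simp only [walkLaw, charFun_apply]
      have hb : ∀ s : ℝ, ‖Complex.exp (inner ℝ s t * Complex.I)‖ ≤ 1 := fun s =>
        (Complex.norm_exp_ofReal_mul_I _).le
      exact integral_add_measure
        ((Integrable.of_bound (by fun_prop) 1 (ae_of_all _ hb)).smul_measure_nnreal)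
        ((Integrable.of_bound (by fun_prop) 1 (ae_of_all _ hb)).smul_measure_nnreal)
    rw [hadd, hs, hs, key, key, ih, pow_succ, Complex.ofReal_cos, Complex.cos]
    push_cast
    simp only [mul_neg, mul_one, neg_mul]
    ring

/-- The central limit theorem for the simple random walk. -/
lemma tendsto_walkLaw_Ici (x : ℝ) :
    Tendsto (fun n : ℕ => (walkLaw n).real (Set.Ici (x * √n))) atTop
      (nhds ((ProbabilityTheory.gaussianReal 0 1).real (Set.Ici x))) := by
  have hone : ∀ t : ℝ, charFun ((walkLaw 1).map id) t = (Real.cos t : ℂ) := by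
    intro t; rw [Measure.map_id, charFun_walkLaw, pow_one]
  have hlaw : ∀ f : ℝ → ℝ, Measurable f → ∫ s, f s ∂(walkLaw 1) = (f (-1) + f 1) / 2 := by
    intro f hf
    have e : walkLaw 1 =
        (2⁻¹ : NNReal) • Measure.dirac (-1) + (2⁻¹ : NNReal) • Measure.dirac 1 := by
      simp only [walkLaw]
      rw [Measure.map_dirac' (by fun_prop), Measure.map_dirac' (by fun_prop)]; simp
    have hi : ∀ c : ℝ, Integrable f (Measure.dirac c) := fun c => by
      exact integrable_dirac (by simp)
    rw [e, integral_add_measure ((hi _).smul_measure_nnreal) ((hi _).smul_measure_nnreal),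
      integral_smul_nnreal_measure, integral_smul_nnreal_measure, integral_dirac, integral_dirac]
    simp [NNReal.smul_def]; ring
  have hchar : ∀ t : ℝ, Tendsto (fun n : ℕ => charFun ((walkLaw n).map (fun s => (√n)⁻¹ * s)) t)
      atTop (nhds (charFun (ProbabilityTheory.gaussianReal 0 1) t)) := by
    intro t
    have := ProbabilityTheory.tendsto_charFun_inv_sqrt_mul_pow (P := walkLaw 1) (X := id)
      (by fun_prop) (by rw [hlaw _ measurable_id]; simp)
      (by
        have := hlaw (fun s => s ^ 2) (by fun_prop)
        simp only [Pi.pow_apply, id]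
        rw [this]; norm_num) t
    simp only [hone] at this
    simpa [charFun_map_mul, charFun_walkLaw, ProbabilityTheory.charFun_gaussianReal, neg_div]
      using this
  let ν : ℕ → ProbabilityMeasure ℝ := fun n =>
    ⟨(walkLaw n).map (fun s => (√n)⁻¹ * s), Measure.isProbabilityMeasure_map (by fun_prop)⟩
  let γ : ProbabilityMeasure ℝ := ⟨ProbabilityTheory.gaussianReal 0 1, inferInstance⟩
  have hν : Tendsto ν atTop (nhds γ) := ProbabilityMeasure.tendsto_iff_tendsto_charFun.2 hchar
  have := ProbabilityTheory.nullSingletonClass_gaussianReal (μ := 0) (v := 1) one_ne_zero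
  have h := ProbabilityMeasure.tendsto_measure_of_null_frontier_of_tendsto' hν (E := Set.Ici x)
    (by rw [frontier_Ici]; simp [γ])
  have h' := (ENNReal.tendsto_toReal (measure_ne_top (γ : Measure ℝ) (Set.Ici x))).comp h
  refine (h'.congr' ?_)
  filter_upwards [eventually_gt_atTop 0] with n hn
  have hn' : 0 < √(n : ℝ) := Real.sqrt_pos.2 (by exact_mod_cast hn)
  simp only [Function.comp, ν, ProbabilityMeasure.coe_mk, Measure.real]
  rw [Measure.map_apply (by fun_prop) measurableSet_Ici]
  congr 2
  ext s
  simp only [Set.mem_preimage, Set.mem_Ici]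
  rw [← div_eq_inv_mul, le_div_iff₀ hn']

/-- The excess of ones over zeros in a uniformly random bit string is a simple random walk. -/
lemma bitAverage_walk (n : ℕ) (x : ℝ) :
    bitAverage n (fun w => if x ≤ 2 * (w.count true : ℝ) - w.length then 1 else 0)
      = (walkLaw n).real (Set.Ici x) := by
  induction n generalizing x with
  | zero => by_cases h : x ≤ 0 <;> simp [bitAverage, walkLaw, Measure.real, h]
  | succ n ih =>
    have h1 : (walkLaw n).map (· + (-1 : ℝ)) (Set.Ici x) = walkLaw n (Set.Ici (x + 1)) := by
      rw [Measure.map_apply (by fun_prop) measurableSet_Ici]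
      congr 1; ext s; simp only [Set.mem_preimage, Set.mem_Ici]
      constructor <;> intro h <;> linarith
    have h2 : (walkLaw n).map (· + (1 : ℝ)) (Set.Ici x) = walkLaw n (Set.Ici (x - 1)) := by
      rw [Measure.map_apply (by fun_prop) measurableSet_Ici]
      congr 1; ext s; simp only [Set.mem_preimage, Set.mem_Ici]
      constructor <;> intro h <;> linarith
    have e : (walkLaw (n + 1)).real (Set.Ici x) =
        ((walkLaw n).real (Set.Ici (x + 1)) + (walkLaw n).real (Set.Ici (x - 1))) / 2 := by
      simp only [Measure.real, walkLaw, Measure.add_apply, Measure.smul_apply, h1, h2]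
      rw [ENNReal.toReal_add (by simp [ENNReal.smul_def, ENNReal.mul_eq_top])
        (by simp [ENNReal.smul_def, ENNReal.mul_eq_top])]
      simp [ENNReal.smul_def]; ring
    rw [e, ← ih, ← ih, bitAverage]
    congr 3
    · ext w
      congr 1
      simp only [List.count_cons, List.length_cons]
      push_cast
      simp only [beq_iff_eq, Bool.false_eq_true, if_false, eq_iff_iff]
      constructor <;> intro h <;> linarith
    · ext w
      congr 1
      simp only [List.count_cons, List.length_cons, eq_iff_iff]
      constructor <;> intro h <;> simp at * <;> linarith

/-! ### The polar transform of posterior laws -/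

lemma sum_zmod_two {M : Type*} [AddCommMonoid M] (f : ZMod 2 → M) : ∑ c, f c = f 0 + f 1 :=
  Fin.sum_univ_two f

lemma zmod_two_eq_zero_or_one (c : ZMod 2) : c = 0 ∨ c = 1 := by
  revert c; decide

/-- The probability of the bit `c` when `1` has probability `a`. -/
def bitWeight (a : 𝕀) (c : ZMod 2) : ℝ := if c = 0 then 1 - a else a

@[simp] lemma bitWeight_zero (a : 𝕀) : bitWeight a 0 = 1 - a := if_pos rfl

@[simp] lemma bitWeight_one (a : 𝕀) : bitWeight a 1 = a := if_neg (by decide)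

lemma bitWeight_nonneg (a : 𝕀) (c : ZMod 2) : 0 ≤ bitWeight a c := by
  unfold bitWeight; split_ifs
  exacts [sub_nonneg.2 a.2.2, a.2.1]

@[fun_prop]
lemma continuous_bitWeight (c : ZMod 2) : Continuous fun a => bitWeight a c := by
  unfold bitWeight; split_ifs <;> fun_prop

/-- The probability that the sum of two independent bits is `1`, from the probabilities that
the single bits are. -/
def sumPosterior (a b : 𝕀) : 𝕀 :=
  ⟨a * (1 - b) + b * (1 - a), by
    have h1 := mul_nonneg a.2.1 (sub_nonneg.2 b.2.2)
    have h2 := mul_nonneg b.2.1 (sub_nonneg.2 a.2.2)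
    have h3 := mul_nonneg a.2.1 b.2.1
    have h4 := mul_nonneg (sub_nonneg.2 a.2.2) (sub_nonneg.2 b.2.2)
    constructor <;> nlinarith⟩

@[fun_prop]
lemma continuous_sumPosterior : Continuous fun p : 𝕀 × 𝕀 => sumPosterior p.1 p.2 := by
  unfold sumPosterior; fun_prop

lemma bitWeight_sumPosterior (a b : 𝕀) (s : ZMod 2) :
    bitWeight (sumPosterior a b) s = ∑ d, bitWeight a (s + d) * bitWeight b d := by
  rw [sum_zmod_two]
  rcases zmod_two_eq_zero_or_one s with rfl | rfl
  · simp [sumPosterior]; ring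
  · simp [sumPosterior, show (1 : ZMod 2) + 1 = 0 from rfl]; ring

/-- The probability that the second of two independent bits is `1`, given that their sum is `s`.
The projection to the unit interval acts trivially; the value is irrelevant if the sum `s` has
probability zero. -/
def condPosterior (s : ZMod 2) (a b : 𝕀) : 𝕀 :=
  Set.projIcc 0 1 zero_le_one (bitWeight a (s + 1) * bitWeight b 1 / bitWeight (sumPosterior a b) s)

@[fun_prop]
lemma measurable_condPosterior (s : ZMod 2) :
    Measurable fun p : 𝕀 × 𝕀 => condPosterior s p.1 p.2 := by
  refine continuous_projIcc.measurable.comp (Measurable.div ?_ ?_)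
  · exact Continuous.measurable (by fun_prop)
  · exact Continuous.measurable (by fun_prop)

/-- Bayes' rule for the second summand given the sum. -/
lemma bitWeight_mul_condPosterior (s d : ZMod 2) (a b : 𝕀) :
    bitWeight (sumPosterior a b) s * bitWeight (condPosterior s a b) d
      = bitWeight a (s + d) * bitWeight b d := by
  have hsum := bitWeight_sumPosterior a b s
  rw [sum_zmod_two] at hsum
  have h0 := mul_nonneg (bitWeight_nonneg a (s + 0)) (bitWeight_nonneg b 0)
  have h1 := mul_nonneg (bitWeight_nonneg a (s + 1)) (bitWeight_nonneg b 1)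
  rcases eq_or_ne (bitWeight (sumPosterior a b) s) 0 with hz | hz
  · rw [hz] at hsum ⊢
    rw [zero_mul]
    rcases zmod_two_eq_zero_or_one d with rfl | rfl <;> linarith
  · have hpos : 0 < bitWeight (sumPosterior a b) s := lt_of_le_of_ne (bitWeight_nonneg _ _) hz.symm
    have hm : bitWeight a (s + 1) * bitWeight b 1 / bitWeight (sumPosterior a b) s
        ∈ Set.Icc (0 : ℝ) 1 := ⟨by positivity, (div_le_one hpos).2 (by linarith)⟩
    have hval : (condPosterior s a b : ℝ)
        = bitWeight a (s + 1) * bitWeight b 1 / bitWeight (sumPosterior a b) s := by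
      unfold condPosterior
      rw [Set.projIcc_of_mem zero_le_one hm]
    rcases zmod_two_eq_zero_or_one d with rfl | rfl
    · rw [bitWeight_zero, hval, mul_sub, mul_div_cancel₀ _ hz]; linarith
    · rw [bitWeight_one, hval, mul_div_cancel₀ _ hz]

/-- The law of the posterior probability of the sum of two inputs whose posterior probabilities
are independent with law `D`. -/
def minusLaw (D : Measure 𝕀) : Measure 𝕀 :=
  (D.prod D).map fun p => sumPosterior p.1 p.2

/-- The law of the posterior probability of the second of two inputs once their sum is known,
where the posterior probabilities of the single inputs are independent with law `D`. -/
def plusLaw (D : Measure 𝕀) : Measure 𝕀 :=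
  ∑ s : ZMod 2, ((D.prod D).withDensity fun p =>
    ENNReal.ofReal (bitWeight (sumPosterior p.1 p.2) s)).map fun p => condPosterior s p.1 p.2

lemma lintegral_minusLaw (D : Measure 𝕀) [SFinite D] {g : 𝕀 → ENNReal} (hg : Measurable g) :
    ∫⁻ x, g x ∂(minusLaw D) = ∫⁻ p, g (sumPosterior p.1 p.2) ∂(D.prod D) :=
  lintegral_map hg (by fun_prop)

lemma measurable_sumWeight (s : ZMod 2) : Measurable fun p : 𝕀 × 𝕀 =>
    ENNReal.ofReal (bitWeight (sumPosterior p.1 p.2) s) :=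
  ENNReal.measurable_ofReal.comp (Continuous.measurable (by fun_prop))

lemma lintegral_plusLaw (D : Measure 𝕀) [SFinite D] {g : 𝕀 → ENNReal} (hg : Measurable g) :
    ∫⁻ x, g x ∂(plusLaw D) = ∫⁻ p, ∑ s, ENNReal.ofReal (bitWeight (sumPosterior p.1 p.2) s) *
      g (condPosterior s p.1 p.2) ∂(D.prod D) := by
  rw [plusLaw, lintegral_finsetSum_measure, lintegral_finsetSum]
  · refine Finset.sum_congr rfl fun s _ => ?_
    rw [lintegral_map hg (by fun_prop)]
    exact lintegral_withDensity_eq_lintegral_mul _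
      (measurable_sumWeight s) (hg.comp (measurable_condPosterior s))
  · exact fun s _ => (measurable_sumWeight s).mul (hg.comp (measurable_condPosterior s))

instance isProbabilityMeasure_minusLaw (D : Measure 𝕀) [IsProbabilityMeasure D] :
    IsProbabilityMeasure (minusLaw D) :=
  Measure.isProbabilityMeasure_map (by fun_prop)

instance isProbabilityMeasure_plusLaw (D : Measure 𝕀) [IsProbabilityMeasure D] :
    IsProbabilityMeasure (plusLaw D) := by
  constructor
  have h := lintegral_plusLaw D (g := fun _ => 1) measurable_const
  rw [lintegral_one] at h
  rw [h]
  have : ∀ p : 𝕀 × 𝕀, ∑ s, ENNReal.ofReal (bitWeight (sumPosterior p.1 p.2) s) * 1 = 1 := by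
    intro p
    simp only [mul_one]
    rw [← ENNReal.ofReal_sum_of_nonneg fun s _ => bitWeight_nonneg _ s, sum_zmod_two]
    simp
  simp only [this]
  simp

lemma integrable_of_measurable_of_abs_le {Ω : Type*} [MeasurableSpace Ω] {P : Measure Ω}
    [IsFiniteMeasure P] {g : Ω → ℝ} (hg : Measurable g) (C : ℝ) (hC : ∀ x, |g x| ≤ C) :
    Integrable g P :=
  Integrable.of_bound hg.aestronglyMeasurable C (ae_of_all _ hC)

lemma integral_minusLaw (D : Measure 𝕀) [IsProbabilityMeasure D] {g : 𝕀 → ℝ}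
    (hg : Measurable g) :
    ∫ x, g x ∂(minusLaw D) = ∫ p, g (sumPosterior p.1 p.2) ∂(D.prod D) :=
  integral_map (by fun_prop) hg.aestronglyMeasurable

lemma integral_plusLaw (D : Measure 𝕀) [IsProbabilityMeasure D] {g : 𝕀 → ℝ}
    (hg : Measurable g) (h0 : ∀ x, 0 ≤ g x) :
    ∫ x, g x ∂(plusLaw D) = ∫ p, ∑ s, bitWeight (sumPosterior p.1 p.2) s *
      g (condPosterior s p.1 p.2) ∂(D.prod D) := by
  have hm : Measurable fun p : 𝕀 × 𝕀 => ∑ s, bitWeight (sumPosterior p.1 p.2) s *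
      g (condPosterior s p.1 p.2) := by
    refine Finset.measurable_fun_sum _ fun s _ => Measurable.mul ?_ (by fun_prop)
    exact Continuous.measurable (by fun_prop)
  rw [integral_eq_lintegral_of_nonneg_ae (ae_of_all _ h0) hg.aestronglyMeasurable,
    integral_eq_lintegral_of_nonneg_ae _ hm.aestronglyMeasurable,
    lintegral_plusLaw D hg.ennreal_ofReal]
  · congr 2
    ext p
    rw [ENNReal.ofReal_sum_of_nonneg fun s _ => mul_nonneg (bitWeight_nonneg _ _) (h0 _)]
    exact Finset.sum_congr rfl fun s _ => (ENNReal.ofReal_mul (bitWeight_nonneg _ _)).symm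
  · exact ae_of_all _ fun p => Finset.sum_nonneg fun s _ =>
      mul_nonneg (bitWeight_nonneg _ _) (h0 _)

/-! ### The Bhattacharyya parameter -/

/-- The contribution `2 √(a (1 - a))` of a posterior probability `a` to the Bhattacharyya
parameter. -/
def bhattacharyyaFun (a : 𝕀) : ℝ := 2 * √(bitWeight a 0 * bitWeight a 1)

lemma bhattacharyyaFun_nonneg (a : 𝕀) : 0 ≤ bhattacharyyaFun a := by
  unfold bhattacharyyaFun; positivity

lemma bhattacharyyaFun_sq (a : 𝕀) : bhattacharyyaFun a ^ 2 = 4 * ((1 - a) * a) := by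
  unfold bhattacharyyaFun
  rw [mul_pow, Real.sq_sqrt (mul_nonneg (bitWeight_nonneg _ _) (bitWeight_nonneg _ _))]
  simp; norm_num

lemma bhattacharyyaFun_le_one (a : 𝕀) : bhattacharyyaFun a ≤ 1 := by
  have h := bhattacharyyaFun_sq a
  nlinarith [bhattacharyyaFun_nonneg a, sq_nonneg (2 * (a : ℝ) - 1)]

@[fun_prop]
lemma continuous_bhattacharyyaFun : Continuous bhattacharyyaFun := by
  unfold bhattacharyyaFun; fun_prop

/-- The Bhattacharyya parameter of a channel with the posterior law `D`. -/
def bhattacharyya (D : Measure 𝕀) : ℝ := ∫ a, bhattacharyyaFun a ∂D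

lemma integrable_bhattacharyyaFun (D : Measure 𝕀) [IsFiniteMeasure D] :
    Integrable bhattacharyyaFun D :=
  integrable_of_measurable_of_abs_le continuous_bhattacharyyaFun.measurable 1 fun a => by
    rw [abs_of_nonneg (bhattacharyyaFun_nonneg a)]; exact bhattacharyyaFun_le_one a

lemma bhattacharyya_nonneg (D : Measure 𝕀) : 0 ≤ bhattacharyya D :=
  integral_nonneg bhattacharyyaFun_nonneg

lemma bhattacharyya_le_one (D : Measure 𝕀) [IsProbabilityMeasure D] : bhattacharyya D ≤ 1 := by
  have := integral_mono (integrable_bhattacharyyaFun D) (integrable_const (1 : ℝ))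
    bhattacharyyaFun_le_one
  simpa [bhattacharyya] using this

lemma bhattacharyya_plusLaw (D : Measure 𝕀) [IsProbabilityMeasure D] :
    bhattacharyya (plusLaw D) = bhattacharyya D ^ 2 := by
  have key : ∀ p : 𝕀 × 𝕀, ∑ s, bitWeight (sumPosterior p.1 p.2) s *
      bhattacharyyaFun (condPosterior s p.1 p.2) =
        bhattacharyyaFun p.1 * bhattacharyyaFun p.2 := by
    rintro ⟨a, b⟩
    have h : ∀ s, bitWeight (sumPosterior a b) s * bhattacharyyaFun (condPosterior s a b)
        = 2 * √((bitWeight a 0 * bitWeight a 1) * (bitWeight b 0 * bitWeight b 1)) := by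
      intro s
      have e : bitWeight (sumPosterior a b) s * bhattacharyyaFun (condPosterior s a b)
          = 2 * √((bitWeight (sumPosterior a b) s * bitWeight (condPosterior s a b) 0) *
            (bitWeight (sumPosterior a b) s * bitWeight (condPosterior s a b) 1)) := by
        rw [show ∀ x y z : ℝ, (x * y) * (x * z) = x ^ 2 * (y * z) by intros; ring,
          Real.sqrt_mul (sq_nonneg _), Real.sqrt_sq (bitWeight_nonneg _ _), bhattacharyyaFun]
        ring
      rw [e, bitWeight_mul_condPosterior, bitWeight_mul_condPosterior]
      congr 2
      rcases zmod_two_eq_zero_or_one s with rfl | rfl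
      · simp only [add_zero, zero_add]; ring
      · simp only [add_zero, show (1 : ZMod 2) + 1 = 0 from rfl]; ring
    rw [sum_zmod_two, h, h, bhattacharyyaFun, bhattacharyyaFun,
      Real.sqrt_mul (mul_nonneg (bitWeight_nonneg _ _) (bitWeight_nonneg _ _))]
    ring
  rw [bhattacharyya, integral_plusLaw D continuous_bhattacharyyaFun.measurable
    bhattacharyyaFun_nonneg]
  simp only [key]
  rw [integral_prod_mul, bhattacharyya, sq]

lemma bhattacharyya_minusLaw_le (D : Measure 𝕀) [IsProbabilityMeasure D] :
    bhattacharyya (minusLaw D) ≤ 2 * bhattacharyya D - bhattacharyya D ^ 2 := by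
  have key : ∀ p : 𝕀 × 𝕀, bhattacharyyaFun (sumPosterior p.1 p.2) ≤
      bhattacharyyaFun p.1 + bhattacharyyaFun p.2 -
        bhattacharyyaFun p.1 * bhattacharyyaFun p.2 := by
    rintro ⟨a, b⟩
    have ha0 := bhattacharyyaFun_nonneg a
    have hb0 := bhattacharyyaFun_nonneg b
    have ha1 := bhattacharyyaFun_le_one a
    have hb1 := bhattacharyyaFun_le_one b
    have hs : bhattacharyyaFun (sumPosterior a b) ^ 2 = bhattacharyyaFun a ^ 2
        + bhattacharyyaFun b ^ 2 - bhattacharyyaFun a ^ 2 * bhattacharyyaFun b ^ 2 := by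
      simp only [bhattacharyyaFun_sq, sumPosterior]; ring
    have hn := bhattacharyyaFun_nonneg (sumPosterior a b)
    simp only
    set x := bhattacharyyaFun a
    set y := bhattacharyyaFun b
    refine le_of_sq_le_sq ?_ (by nlinarith)
    rw [hs]
    have h1 := mul_nonneg (mul_nonneg ha0 hb0) (mul_nonneg (sub_nonneg.2 ha1) (sub_nonneg.2 hb1))
    nlinarith
  have hi1 : Integrable (fun p : 𝕀 × 𝕀 => bhattacharyyaFun p.1) (D.prod D) :=
    (integrable_bhattacharyyaFun D).comp_fst D
  have hi2 : Integrable (fun p : 𝕀 × 𝕀 => bhattacharyyaFun p.2) (D.prod D) :=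
    (integrable_bhattacharyyaFun D).comp_snd D
  have hi3 : Integrable (fun p : 𝕀 × 𝕀 => bhattacharyyaFun p.1 * bhattacharyyaFun p.2)
      (D.prod D) := (integrable_bhattacharyyaFun D).mul_prod (integrable_bhattacharyyaFun D)
  have hi12 : Integrable (fun p : 𝕀 × 𝕀 => bhattacharyyaFun p.1 + bhattacharyyaFun p.2)
      (D.prod D) := hi1.add hi2
  rw [bhattacharyya, integral_minusLaw D continuous_bhattacharyyaFun.measurable]
  refine (integral_mono ?_ (hi12.sub hi3) key).trans ?_
  · refine integrable_of_measurable_of_abs_le (Continuous.measurable (by fun_prop)) 1 fun p => ?_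
    rw [abs_of_nonneg (bhattacharyyaFun_nonneg _)]; exact bhattacharyyaFun_le_one _
  · rw [integral_sub' hi12 hi3, integral_add hi1 hi2, integral_prod_mul,
      integral_fun_fst, integral_fun_snd, bhattacharyya]
    simp; nlinarith

/-! ### The conditional entropy -/

/-- The conditional entropy of the input given the output, in bits, of a channel with the
posterior law `D`. -/
def condEntropy (D : Measure 𝕀) : ℝ := ∫ a : 𝕀, Real.binEntropy a / Real.log 2 ∂D

lemma binEntropy_div_mem (a : 𝕀) :
    0 ≤ Real.binEntropy a / Real.log 2 ∧ Real.binEntropy a / Real.log 2 ≤ 1 :=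
  ⟨div_nonneg (Real.binEntropy_nonneg a.2.1 a.2.2) (Real.log_nonneg one_le_two),
    (div_le_one (Real.log_pos one_lt_two)).2 Real.binEntropy_le_log_two⟩

lemma measurable_binEntropy_div : Measurable fun a : 𝕀 => Real.binEntropy a / Real.log 2 :=
  Continuous.measurable (by fun_prop)

lemma integrable_binEntropy_div (D : Measure 𝕀) [IsFiniteMeasure D] :
    Integrable (fun a : 𝕀 => Real.binEntropy a / Real.log 2) D :=
  integrable_of_measurable_of_abs_le measurable_binEntropy_div 1 fun a => by
    rw [abs_of_nonneg (binEntropy_div_mem a).1]; exact (binEntropy_div_mem a).2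

/-- The chain rule: the entropy of a pair of bits is the entropy of their sum plus the conditional
entropy of the second bit given the sum. -/
lemma binEntropy_sumPosterior_add (a b : 𝕀) :
    Real.binEntropy (sumPosterior a b) + ∑ s, bitWeight (sumPosterior a b) s *
      Real.binEntropy (condPosterior s a b) = Real.binEntropy a + Real.binEntropy b := by
  have hb : ∀ x : 𝕀, Real.binEntropy x =
      Real.negMulLog (bitWeight x 0) + Real.negMulLog (bitWeight x 1) := by
    intro x
    rw [bitWeight_zero, bitWeight_one, Real.binEntropy_eq_negMulLog_add_negMulLog_one_sub, add_comm]
  have hs : ∀ s, bitWeight (sumPosterior a b) s * Real.binEntropy (condPosterior s a b) =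
      Real.negMulLog (bitWeight a (s + 0) * bitWeight b 0) +
      Real.negMulLog (bitWeight a (s + 1) * bitWeight b 1) -
      Real.negMulLog (bitWeight (sumPosterior a b) s) := by
    intro s
    rw [← bitWeight_mul_condPosterior, ← bitWeight_mul_condPosterior, Real.negMulLog_mul,
      Real.negMulLog_mul, hb]
    simp only [bitWeight_zero, bitWeight_one]
    ring
  simp only [hs, sum_zmod_two, hb (sumPosterior a b), hb a, hb b, add_zero, zero_add,
    show (1 : ZMod 2) + 1 = 0 from rfl, Real.negMulLog_mul]
  simp only [bitWeight_zero, bitWeight_one]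
  ring

lemma condEntropy_minusLaw_add_plusLaw (D : Measure 𝕀) [IsProbabilityMeasure D] :
    condEntropy (minusLaw D) + condEntropy (plusLaw D) = 2 * condEntropy D := by
  have hi1 := (integrable_binEntropy_div D).comp_fst D
  have hi2 := (integrable_binEntropy_div D).comp_snd D
  have hm : Integrable (fun p : 𝕀 × 𝕀 => Real.binEntropy (sumPosterior p.1 p.2) / Real.log 2)
      (D.prod D) := by
    refine integrable_of_measurable_of_abs_le (Continuous.measurable (by fun_prop)) 1 fun p => ?_
    rw [abs_of_nonneg (binEntropy_div_mem _).1]; exact (binEntropy_div_mem _).2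
  have hi12 : Integrable (fun p : 𝕀 × 𝕀 =>
      Real.binEntropy p.1 / Real.log 2 + Real.binEntropy p.2 / Real.log 2) (D.prod D) :=
    hi1.add hi2
  have key : ∀ p : 𝕀 × 𝕀, ∑ s, bitWeight (sumPosterior p.1 p.2) s *
      (Real.binEntropy (condPosterior s p.1 p.2) / Real.log 2) =
        Real.binEntropy p.1 / Real.log 2 + Real.binEntropy p.2 / Real.log 2
          - Real.binEntropy (sumPosterior p.1 p.2) / Real.log 2 := by
    intro p
    simp only [← mul_div_assoc, ← Finset.sum_div]
    rw [eq_sub_of_add_eq' (binEntropy_sumPosterior_add p.1 p.2)]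
    ring
  rw [condEntropy, condEntropy, integral_minusLaw D measurable_binEntropy_div,
    integral_plusLaw D measurable_binEntropy_div fun a => (binEntropy_div_mem a).1]
  simp only [key]
  rw [integral_sub hi12 hm, integral_add hi1 hi2]
  simp only [integral_fun_fst (fun a : 𝕀 => Real.binEntropy a / Real.log 2),
    integral_fun_snd (fun a : 𝕀 => Real.binEntropy a / Real.log 2), condEntropy]
  simp; ring

/-- A chord bound: the binary entropy is at least twice the smaller probability. -/
lemma one_sub_binEntropy_le (a : 𝕀) :
    1 - Real.binEntropy a / Real.log 2 ≤ |1 - 2 * (a : ℝ)| := by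
  have hl := Real.log_pos one_lt_two
  have hconc := Real.strictConcave_binEntropy.concaveOn
  have chord : ∀ x : ℝ, 0 ≤ x → x ≤ 2⁻¹ → 2 * x * Real.log 2 ≤ Real.binEntropy x := by
    intro x h0 h1
    have h2 := hconc.2
    have := h2 (show (0 : ℝ) ∈ Set.Icc 0 1 by norm_num) (show (2⁻¹ : ℝ) ∈ Set.Icc 0 1 by norm_num)
      (show 0 ≤ 1 - 2 * x by linarith) (show 0 ≤ 2 * x by linarith) (by ring)
    simpa [show 2 * x * 2⁻¹ = x by ring] using this
  rw [sub_le_iff_le_add]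
  rcases le_total (a : ℝ) 2⁻¹ with h | h
  · have := (le_div_iff₀ hl).2 (chord a a.2.1 h)
    linarith [le_abs_self (1 - 2 * (a : ℝ))]
  · have := chord (1 - a) (by linarith [a.2.2]) (by linarith)
    rw [Real.binEntropy_one_sub] at this
    have := (le_div_iff₀ hl).2 this
    linarith [neg_abs_le (1 - 2 * (a : ℝ))]

/-- A channel with Bhattacharyya parameter close to one has small capacity. -/
lemma one_sub_condEntropy_le (D : Measure 𝕀) [IsProbabilityMeasure D] {c : ℝ} (hc : 0 < c) :
    1 - condEntropy D ≤ c + (1 - bhattacharyya D) / (2 * c) := by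
  have key : ∀ a : 𝕀, 1 - Real.binEntropy a / Real.log 2 ≤
      c + (1 - bhattacharyyaFun a) / (2 * c) := by
    intro a
    refine (one_sub_binEntropy_le a).trans ?_
    -- `|x| ≤ c + x² / (4c)` for `x = 1 - 2a`, and `x² = 1 - z²` for `z = 2 √(a (1 - a))`
    have hz := bhattacharyyaFun_sq a
    have hz1 := bhattacharyyaFun_le_one a
    rw [← sub_le_iff_le_add', le_div_iff₀ (by linarith)]
    nlinarith [sq_nonneg (|1 - 2 * (a : ℝ)| - 2 * c), sq_abs (1 - 2 * (a : ℝ)),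
      sq_nonneg (1 - bhattacharyyaFun a)]
  have hH := integrable_binEntropy_div D
  have hZ := integrable_bhattacharyyaFun D
  have hZ' : Integrable (fun a : 𝕀 => (1 - bhattacharyyaFun a) / (2 * c)) D :=
    ((integrable_const (1 : ℝ)).sub hZ).div_const (2 * c)
  calc 1 - condEntropy D = ∫ a : 𝕀, (1 - Real.binEntropy a / Real.log 2) ∂D := by
        rw [integral_sub (integrable_const _) hH, condEntropy]; simp
    _ ≤ ∫ a, (c + (1 - bhattacharyyaFun a) / (2 * c)) ∂D :=
        integral_mono ((integrable_const (1 : ℝ)).sub hH) ((integrable_const c).add hZ') key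
    _ = c + (1 - bhattacharyya D) / (2 * c) := by
        rw [integral_add (integrable_const _) hZ', integral_div,
          integral_sub (integrable_const _) hZ, bhattacharyya]
        simp

lemma condEntropy_nonneg (D : Measure 𝕀) : 0 ≤ condEntropy D :=
  integral_nonneg fun a => (binEntropy_div_mem a).1

/-! ### Polarization along the tree of transforms -/

/-- The posterior law that results from `D` by a sequence of transforms, the first of which is the
head of the list; `true` stands for the plus transform and `false` for the minus transform. -/
def iteratedLaw (D : Measure 𝕀) : List Bool → Measure 𝕀
  | [] => D
  | false :: w => iteratedLaw (minusLaw D) w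
  | true :: w => iteratedLaw (plusLaw D) w

lemma iteratedLaw_append (D : Measure 𝕀) (v w : List Bool) :
    iteratedLaw D (v ++ w) = iteratedLaw (iteratedLaw D v) w := by
  induction v generalizing D with
  | nil => rfl
  | cons b v ih => cases b <;> simp [iteratedLaw, ih]

instance isProbabilityMeasure_iteratedLaw (D : Measure 𝕀) [IsProbabilityMeasure D]
    (w : List Bool) : IsProbabilityMeasure (iteratedLaw D w) := by
  induction w generalizing D with
  | nil => assumption
  | cons b w ih => cases b <;> exact ih _

lemma bitAverage_condEntropy (D : Measure 𝕀) [IsProbabilityMeasure D] (n : ℕ) :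
    bitAverage n (fun w => condEntropy (iteratedLaw D w)) = condEntropy D := by
  induction n generalizing D with
  | zero => rfl
  | succ n ih =>
    simp only [bitAverage, iteratedLaw, ih]
    linarith [condEntropy_minusLaw_add_plusLaw D]

/-- The Bhattacharyya parameters form a bounded supermartingale, so that their increments are
square summable; the plus transform moves `z` by `z (1 - z)`. -/
lemma sum_bitAverage_sq_le (D : Measure 𝕀) [IsProbabilityMeasure D] (n : ℕ) :
    ∑ k ∈ Finset.range n, bitAverage k (fun w => (bhattacharyya (iteratedLaw D w) *
      (1 - bhattacharyya (iteratedLaw D w))) ^ 2) ≤ 2 := by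
  -- the square accounts for the increments, the linear term for the negative drift of `z`
  let φ : ℝ → ℝ := fun z => z ^ 2 - 2 * z
  have hstep : ∀ k, bitAverage k (fun w => φ (bhattacharyya (iteratedLaw D w))) +
      1 / 2 * bitAverage k (fun w => (bhattacharyya (iteratedLaw D w) *
        (1 - bhattacharyya (iteratedLaw D w))) ^ 2) ≤
      bitAverage (k + 1) (fun w => φ (bhattacharyya (iteratedLaw D w))) := by
    intro k
    rw [bitAverage_succ_last, ← bitAverage_const_mul, ← bitAverage_add]
    refine bitAverage_mono k fun w _ => ?_
    simp only [iteratedLaw_append, iteratedLaw, φ, bhattacharyya_plusLaw]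
    have h1 := bhattacharyya_minusLaw_le (iteratedLaw D w)
    have h2 := bhattacharyya_le_one (iteratedLaw D w)
    set x := bhattacharyya (iteratedLaw D w)
    set m := bhattacharyya (minusLaw (iteratedLaw D w))
    nlinarith [mul_nonneg (sub_nonneg.2 h1) (sub_nonneg.2 h2), sq_nonneg (m - x)]
  have htel : ∀ k, φ (bhattacharyya D) + 1 / 2 * ∑ k ∈ Finset.range k,
      bitAverage k (fun w => (bhattacharyya (iteratedLaw D w) *
        (1 - bhattacharyya (iteratedLaw D w))) ^ 2) ≤
      bitAverage k (fun w => φ (bhattacharyya (iteratedLaw D w))) := by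
    intro k
    induction k with
    | zero => simp [bitAverage, iteratedLaw]
    | succ k ih => rw [Finset.sum_range_succ]; linarith [hstep k]
  have hub : bitAverage n (fun w => φ (bhattacharyya (iteratedLaw D w))) ≤ 0 := by
    rw [← bitAverage_const n 0]
    refine bitAverage_mono n fun w _ => ?_
    nlinarith [bhattacharyya_le_one (iteratedLaw D w), bhattacharyya_nonneg (iteratedLaw D w)]
  have hlb : -1 ≤ φ (bhattacharyya D) := by
    simp only [φ]; nlinarith [sq_nonneg (bhattacharyya D - 1)]
  linarith [htel n]

/-- The fraction of nearly noiseless channels after sufficiently many transforms is almost the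
capacity. -/
lemma exists_bitAverage_bhattacharyya_le (D : Measure 𝕀) [IsProbabilityMeasure D] {ε η : ℝ}
    (hε : 0 < ε) (hη : 0 < η) :
    ∃ m, 1 - condEntropy D - η ≤
      bitAverage m (fun w => if bhattacharyya (iteratedLaw D w) ≤ ε then 1 else 0) := by
  set c := η / 4 with hc
  set ε' := 2 * c * (η / 4) with hε'
  have hc0 : 0 < c := by positivity
  have hε'0 : 0 < ε' := by positivity
  set δ := (ε * ε') ^ 2 * (η / 2) with hδ
  have hδ0 : 0 < δ := by positivity
  obtain ⟨m, hm⟩ : ∃ m, bitAverage m (fun w => (bhattacharyya (iteratedLaw D w) *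
      (1 - bhattacharyya (iteratedLaw D w))) ^ 2) ≤ δ := by
    by_contra! h
    obtain ⟨n, hn⟩ := exists_nat_gt (2 / δ)
    have h1 := sum_bitAverage_sq_le D n
    have h2 := Finset.card_nsmul_le_sum (Finset.range n) _ δ fun k _ => (h k).le
    rw [Finset.card_range, nsmul_eq_mul] at h2
    rw [div_lt_iff₀ hδ0] at hn
    linarith
  refine ⟨m, ?_⟩
  have key : ∀ w, 1 + -1 * condEntropy (iteratedLaw D w) ≤
      (if bhattacharyya (iteratedLaw D w) ≤ ε then 1 else 0) + (c + η / 4 +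
        ((ε * ε') ^ 2)⁻¹ * (bhattacharyya (iteratedLaw D w) *
          (1 - bhattacharyya (iteratedLaw D w))) ^ 2) := by
    intro w
    have h0 := condEntropy_nonneg (iteratedLaw D w)
    have hz1 := bhattacharyya_le_one (iteratedLaw D w)
    have hq : 0 ≤ ((ε * ε') ^ 2)⁻¹ * (bhattacharyya (iteratedLaw D w) *
      (1 - bhattacharyya (iteratedLaw D w))) ^ 2 := by positivity
    split_ifs with h
    · linarith
    · push Not at h
      by_cases h' : 1 - bhattacharyya (iteratedLaw D w) ≤ ε'
      · have h2 := one_sub_condEntropy_le (iteratedLaw D w) hc0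
        have h3 : (1 - bhattacharyya (iteratedLaw D w)) / (2 * c) ≤ η / 4 := by
          rw [div_le_iff₀ (by positivity)]; linarith
        linarith
      · push Not at h'
        have h4 : 1 ≤ ((ε * ε') ^ 2)⁻¹ * (bhattacharyya (iteratedLaw D w) *
            (1 - bhattacharyya (iteratedLaw D w))) ^ 2 := by
          rw [← div_eq_inv_mul, one_le_div (by positivity)]
          have := hε.le.trans h.le
          gcongr
        linarith
  have h := bitAverage_mono m fun w _ => key w
  simp only [bitAverage_add, bitAverage_const_mul, bitAverage_const, bitAverage_condEntropy] at h
  have h5 : ((ε * ε') ^ 2)⁻¹ * bitAverage m (fun w => (bhattacharyya (iteratedLaw D w) *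
      (1 - bhattacharyya (iteratedLaw D w))) ^ 2) ≤ η / 2 := by
    rw [← div_eq_inv_mul, div_le_iff₀ (by positivity)]; linarith
  linarith

/-! ### The speed of polarization -/

/-- The total loss in the exponent of the Bhattacharyya parameter along a path, when a minus
transform that follows `k` plus transforms is charged `2 ^ (-k)`. -/
def exponentLoss : List Bool → ℝ
  | [] => 0
  | false :: w => 1 + exponentLoss w
  | true :: w => exponentLoss w / 2

lemma exponentLoss_nonneg (w : List Bool) : 0 ≤ exponentLoss w := by
  induction w with
  | nil => exact le_rfl
  | cons b w ih => cases b <;> simp only [exponentLoss] <;> linarith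

lemma bitAverage_exponentLoss_le (n : ℕ) : bitAverage n exponentLoss ≤ 2 := by
  induction n with
  | zero => norm_num [bitAverage, exponentLoss]
  | succ n ih =>
    have h : bitAverage n (fun w => exponentLoss w / 2) = 1 / 2 * bitAverage n exponentLoss := by
      rw [← bitAverage_const_mul]; congr 1; ext w; ring
    simp only [bitAverage, exponentLoss, bitAverage_add, bitAverage_const, h]
    linarith

/-- A plus transform doubles the exponent, a minus transform lowers it by at most one. -/
lemma bhattacharyya_iteratedLaw_le (D : Measure 𝕀) [IsProbabilityMeasure D] (w : List Bool)
    {K : ℝ} (hK : bhattacharyya D ≤ 2 ^ (-K)) :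
    bhattacharyya (iteratedLaw D w) ≤
      (2 : ℝ) ^ (-((2 : ℝ) ^ w.count true * (K - exponentLoss w))) := by
  induction w generalizing D K with
  | nil => simpa [iteratedLaw, exponentLoss] using hK
  | cons b w ih =>
    cases b
    · have h : bhattacharyya (minusLaw D) ≤ 2 ^ (-(K - 1)) := by
        rw [show -(K - 1) = -K + 1 by ring, Real.rpow_add two_pos, Real.rpow_one]
        nlinarith [bhattacharyya_minusLaw_le D, sq_nonneg (bhattacharyya D)]
      have := ih (minusLaw D) h
      simp only [iteratedLaw, exponentLoss]
      rwa [List.count_cons_of_ne (by decide), show K - (1 + exponentLoss w) =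
        K - 1 - exponentLoss w by ring]
    · have h : bhattacharyya (plusLaw D) ≤ 2 ^ (-(2 * K)) := by
        rw [bhattacharyya_plusLaw, show -(2 * K) = -K * (2 : ℕ) by push_cast; ring,
          Real.rpow_mul two_pos.le, Real.rpow_natCast]
        exact pow_le_pow_left₀ (bhattacharyya_nonneg D) hK 2
      have := ih (plusLaw D) h
      simp only [iteratedLaw, exponentLoss]
      rwa [List.count_cons_self, pow_succ, show (2 : ℝ) ^ w.count true * 2 *
        (K - exponentLoss w / 2) = 2 ^ w.count true * (2 * K - exponentLoss w) by ring]

/-- From a good channel, up to a small fraction of the paths, the exponent of the Bhattacharyya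
parameter is at least `2` to the number of plus transforms. -/
lemma bitAverage_le_bhattacharyya_iteratedLaw (D : Measure 𝕀) [IsProbabilityMeasure D] {η : ℝ}
    (hη : 0 < η) (hD : bhattacharyya D ≤ 2 ^ (-(1 + 2 / η))) (n : ℕ) (x : ℝ) :
    bitAverage n (fun w => if x ≤ w.count true then 1 else 0) - η ≤
      bitAverage n (fun w => if bhattacharyya (iteratedLaw D w) ≤ (2 : ℝ) ^ (-(2 : ℝ) ^ x)
        then 1 else 0) := by
  have key : ∀ w : List Bool, (if x ≤ w.count true then (1 : ℝ) else 0) ≤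
      (if bhattacharyya (iteratedLaw D w) ≤ (2 : ℝ) ^ (-(2 : ℝ) ^ x) then 1 else 0)
        + η / 2 * exponentLoss w := by
    intro w
    have h0 := mul_nonneg (half_pos hη).le (exponentLoss_nonneg w)
    split_ifs with h1 h2 h2
    · linarith
    · -- Markov's inequality: the exponent can only be too small if the loss exceeds `2 / η`
      rw [zero_add]
      by_contra! h3
      apply h2
      refine (bhattacharyya_iteratedLaw_le D w hD).trans ?_
      refine Real.rpow_le_rpow_of_exponent_le one_le_two (neg_le_neg ?_)
      have h4 : (2 : ℝ) ^ x ≤ 2 ^ w.count true := by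
        rw [← Real.rpow_natCast]; exact Real.rpow_le_rpow_of_exponent_le one_le_two h1
      have h5 : exponentLoss w ≤ 2 / η := by
        rw [le_div_iff₀ hη]; linarith
      have h6 : (0 : ℝ) < 2 ^ w.count true := by positivity
      nlinarith
    · linarith
    · linarith
  have h := bitAverage_mono n fun w _ => key w
  rw [bitAverage_add, bitAverage_const_mul] at h
  nlinarith [bitAverage_exponentLoss_le n]

/-- A bounded number of additional steps is negligible on the scale `√n`. -/
lemma eventually_shift_le (m : ℕ) {t t' : ℝ} (h : t < t') :
    ∀ᶠ n : ℕ in atTop, m + t * √(m + n : ℕ) ≤ t' * √n := by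
  have hs : Tendsto (fun n : ℕ => (t' - t) * √(n : ℝ)) atTop atTop :=
    (Real.tendsto_sqrt_atTop.comp tendsto_natCast_atTop_atTop).const_mul_atTop (sub_pos.2 h)
  filter_upwards [hs.eventually_ge_atTop (m + |t| * √m)] with n hn
  have h1 : √(m + n : ℕ) ≤ √m + √n := by
    rw [Real.sqrt_le_left (by positivity), add_sq, Real.sq_sqrt (by positivity),
      Real.sq_sqrt (by positivity)]
    push_cast
    nlinarith [Real.sqrt_nonneg (m : ℝ), Real.sqrt_nonneg (n : ℝ)]
  have h2 : √(n : ℝ) ≤ √(m + n : ℕ) := Real.sqrt_le_sqrt (by simp)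
  have h3 : t * (√(m + n : ℕ) - √n) ≤ |t| * √m :=
    mul_le_mul (le_abs_self t) (by linarith) (by linarith) (abs_nonneg t)
  linarith

/-- The rate-dependent speed of polarization: a fraction of almost `(1 - condEntropy D) Q(t)` of
the channels has a Bhattacharyya parameter of doubly exponential order `(n + t √n) / 2`. -/
lemma eventually_le_bitAverage (D : Measure 𝕀) [IsProbabilityMeasure D] {t t' ρ : ℝ}
    (htt : t < t') (hD : 0 < 1 - condEntropy D)
    (hρ : ρ < (1 - condEntropy D) * (ProbabilityTheory.gaussianReal 0 1).real (Set.Ici t'))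
    (hQ : 0 < (ProbabilityTheory.gaussianReal 0 1).real (Set.Ici t')) :
    ∀ᶠ n : ℕ in atTop, ρ ≤ bitAverage n (fun w => if bhattacharyya (iteratedLaw D w) ≤
      (2 : ℝ) ^ (-(2 : ℝ) ^ (((n : ℝ) + t * √n) / 2)) then 1 else 0) := by
  set C := 1 - condEntropy D with hC
  set q := (ProbabilityTheory.gaussianReal 0 1).real (Set.Ici t') with hq
  obtain ⟨η, hη, h1, h2, h3⟩ : ∃ η > 0, 0 < C - η ∧ 0 < q - 2 * η ∧
      ρ < (C - η) * (q - 2 * η) := by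
    have ha : Tendsto (fun η : ℝ => C - η) (nhdsWithin 0 (Set.Ioi 0)) (nhds C) := by
      refine tendsto_nhdsWithin_of_tendsto_nhds ?_
      exact Continuous.tendsto' (by fun_prop) _ _ (by simp)
    have hb : Tendsto (fun η : ℝ => q - 2 * η) (nhdsWithin 0 (Set.Ioi 0)) (nhds q) := by
      refine tendsto_nhdsWithin_of_tendsto_nhds ?_
      exact Continuous.tendsto' (by fun_prop) _ _ (by simp)
    obtain ⟨η, h⟩ := (((ha.eventually (lt_mem_nhds hD)).and (hb.eventually (lt_mem_nhds hQ))).and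
      (((ha.mul hb).eventually (lt_mem_nhds hρ)).and self_mem_nhdsWithin)).exists
    exact ⟨η, h.2.2, h.1.1, h.1.2, h.2.1⟩
  -- after `m` steps almost all of the capacity sits in channels good enough for the speed bound
  obtain ⟨m, hm⟩ := exists_bitAverage_bhattacharyya_le D
    (ε := 2 ^ (-(1 + 2 / η))) (by positivity) hη
  have hclt := (tendsto_walkLaw_Ici t').eventually (lt_mem_nhds (sub_lt_self q hη))
  suffices ∀ᶠ n : ℕ in atTop, ρ ≤ bitAverage (n + m) (fun w =>
      if bhattacharyya (iteratedLaw D w) ≤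
        (2 : ℝ) ^ (-(2 : ℝ) ^ ((((n + m : ℕ) : ℝ) + t * √(n + m : ℕ)) / 2)) then 1 else 0) by
    rw [← map_add_atTop_eq_nat m]
    exact this
  filter_upwards [hclt, eventually_shift_le m htt] with n hn hshift
  rw [add_comm n m, bitAverage_append]
  set x : ℝ := (((m + n : ℕ) : ℝ) + t * √(m + n : ℕ)) / 2 with hx
  have hP : q - η ≤ bitAverage n (fun w => if x ≤ w.count true then 1 else 0) := by
    rw [← bitAverage_walk] at hn
    refine hn.le.trans (bitAverage_mono n fun w hw => ?_)
    have : t' * √n ≤ 2 * (w.count true : ℝ) - w.length → x ≤ w.count true := by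
      intro h
      rw [hw] at h
      rw [hx]
      push_cast at hshift ⊢
      linarith
    split_ifs with ha hb hb
    · exact le_rfl
    · exact absurd (this ha) hb
    · exact zero_le_one
    · exact le_rfl
  have hinner : ∀ v : List Bool, (q - 2 * η) *
      (if bhattacharyya (iteratedLaw D v) ≤ 2 ^ (-(1 + 2 / η)) then 1 else 0) ≤
      bitAverage n (fun w => if bhattacharyya (iteratedLaw D (v ++ w)) ≤ (2 : ℝ) ^ (-(2 : ℝ) ^ x)
        then 1 else 0) := by
    intro v
    split_ifs with hv
    · have := bitAverage_le_bhattacharyya_iteratedLaw (iteratedLaw D v) hη hv n x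
      simp only [iteratedLaw_append]
      linarith
    · rw [mul_zero]
      exact bitAverage_nonneg n fun w => by positivity
  have h := bitAverage_mono m fun v _ => hinner v
  rw [bitAverage_const_mul] at h
  nlinarith

/-! ### The recursive structure of the polar transform -/

/-- The position of a pair in the lexicographic order used by `polarMatrix`. -/
def pairIndex (n : ℕ) : Fin (2 ^ n) × Fin 2 ≃ Fin (2 ^ (n + 1)) :=
  finProdFinEquiv.trans (finCongr (pow_succ 2 n).symm)

lemma pairIndex_val (n : ℕ) (a : Fin (2 ^ n)) (b : Fin 2) :
    (pairIndex n (a, b)).val = b.val + 2 * a.val := rfl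

lemma pairIndex_lt_iff {n : ℕ} {a c : Fin (2 ^ n)} {b d : Fin 2} :
    pairIndex n (a, b) < pairIndex n (c, d) ↔ a < c ∨ a = c ∧ b < d := by
  simp only [Fin.lt_def, pairIndex_val, Fin.ext_iff]
  omega

lemma forall_pairIndex {n : ℕ} {P : Fin (2 ^ (n + 1)) → Prop} :
    (∀ k, P k) ↔ ∀ a, P (pairIndex n (a, 0)) ∧ P (pairIndex n (a, 1)) := by
  rw [(pairIndex n).forall_congr_right.symm, Prod.forall]
  simp only [Fin.forall_fin_two]

/-- The word with the entries of `x` at the even and those of `y` at the odd positions. -/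
def interleave {α : Type*} {n : ℕ} (x y : Fin (2 ^ n) → α) (k : Fin (2 ^ (n + 1))) : α :=
  if ((pairIndex n).symm k).2 = 0 then x ((pairIndex n).symm k).1 else y ((pairIndex n).symm k).1

@[simp]
lemma interleave_pairIndex_zero {α : Type*} {n : ℕ} (x y : Fin (2 ^ n) → α) (a : Fin (2 ^ n)) :
    interleave x y (pairIndex n (a, 0)) = x a := by
  simp [interleave]

@[simp]
lemma interleave_pairIndex_one {α : Type*} {n : ℕ} (x y : Fin (2 ^ n) → α) (a : Fin (2 ^ n)) :
    interleave x y (pairIndex n (a, 1)) = y a := by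
  simp [interleave]

@[to_additive]
lemma prod_pairIndex {M : Type*} [CommMonoid M] {n : ℕ} (f : Fin (2 ^ (n + 1)) → M) :
    ∏ k, f k = (∏ a, f (pairIndex n (a, 0))) * ∏ a, f (pairIndex n (a, 1)) := by
  rw [← (pairIndex n).prod_comp, Fintype.prod_prod_type]
  simp only [Fin.prod_univ_two, Finset.prod_mul_distrib]

/-- Adding to the first of two words the second one and interleaving: the last step of the polar
transform, as a bijection. -/
def polarStep (n : ℕ) :
    (Fin (2 ^ n) → ZMod 2) × (Fin (2 ^ n) → ZMod 2) ≃ (Fin (2 ^ (n + 1)) → ZMod 2) where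
  toFun u := interleave (u.1 + u.2) u.2
  invFun u := (fun a => u (pairIndex n (a, 0)) + u (pairIndex n (a, 1)),
    fun a => u (pairIndex n (a, 1)))
  left_inv u := by
    ext a <;> simp [add_assoc, CharTwo.add_self_eq_zero]
  right_inv u := by
    funext k
    revert k
    rw [forall_pairIndex]
    intro a
    simp [add_assoc, CharTwo.add_self_eq_zero]

@[simp]
lemma polarStep_pairIndex_zero {n : ℕ} (u v : Fin (2 ^ n) → ZMod 2) (a : Fin (2 ^ n)) :
    polarStep n (u, v) (pairIndex n (a, 0)) = u a + v a :=
  interleave_pairIndex_zero _ _ _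

@[simp]
lemma polarStep_pairIndex_one {n : ℕ} (u v : Fin (2 ^ n) → ZMod 2) (a : Fin (2 ^ n)) :
    polarStep n (u, v) (pairIndex n (a, 1)) = v a :=
  interleave_pairIndex_one _ _ _

lemma polarMatrix_pairIndex {n : ℕ} (a c : Fin (2 ^ n)) (b d : Fin 2) :
    polarMatrix (n + 1) (pairIndex n (a, b)) (pairIndex n (c, d)) =
      polarMatrix n a c * polarKernel b d := by
  change (Matrix.reindex (pairIndex n) (pairIndex n)
    (Matrix.kronecker (polarMatrix n) polarKernel)) _ _ = _
  simp [Matrix.kroneckerMap_apply]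

lemma vecMul_polarStep {n : ℕ} (u v : Fin (2 ^ n) → ZMod 2) :
    Matrix.vecMul (polarStep n (u, v)) (polarMatrix (n + 1)) =
      interleave (Matrix.vecMul u (polarMatrix n)) (Matrix.vecMul v (polarMatrix n)) := by
  funext k
  revert k
  rw [forall_pairIndex]
  intro a
  simp only [Matrix.vecMul, dotProduct, interleave_pairIndex_zero, interleave_pairIndex_one,
    sum_pairIndex, polarStep_pairIndex_zero, polarStep_pairIndex_one, polarMatrix_pairIndex,
    ← Finset.sum_add_distrib]
  constructor <;> refine Finset.sum_congr rfl fun c _ => ?_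
  · simp only [polarKernel, Matrix.of_apply, Matrix.cons_val', Matrix.cons_val_zero,
      Matrix.cons_val_one, Matrix.cons_val_fin_one]
    linear_combination v c * polarMatrix n c a * (CharTwo.two_eq_zero (R := ZMod 2))
  · simp [polarKernel]

lemma measurable_interleave {Y : Type*} [MeasurableSpace Y] {n : ℕ} :
    Measurable fun y : (Fin (2 ^ n) → Y) × (Fin (2 ^ n) → Y) => interleave y.1 y.2 := by
  refine measurable_pi_lambda _ fun k => ?_
  unfold interleave
  split_ifs <;> fun_prop

namespace BinaryInputChannel

variable {Y : Type*} [MeasurableSpace Y] {μ : Measure Y} (W : BinaryInputChannel Y μ)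

instance isProbabilityMeasure_outputLaw (x : ZMod 2) : IsProbabilityMeasure (W.outputLaw x) :=
  ⟨by rw [outputLaw, withDensity_apply _ MeasurableSet.univ, Measure.restrict_univ,
    W.lintegral_eq_one]⟩

instance isProbabilityMeasure_blockLaw {n : ℕ} (x : Fin (2 ^ n) → ZMod 2) :
    IsProbabilityMeasure (W.blockLaw x) := by
  unfold blockLaw; infer_instance

lemma lintegral_outputLaw (x : ZMod 2) {g : Y → ENNReal} (hg : Measurable g) :
    ∫⁻ y, g y ∂(W.outputLaw x) = ∫⁻ y, ENNReal.ofReal (W.p x y) * g y ∂μ :=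
  lintegral_withDensity_eq_lintegral_mul _ (W.measurable_p x).ennreal_ofReal hg

lemma blockLaw_interleave {n : ℕ} (x x' : Fin (2 ^ n) → ZMod 2) :
    W.blockLaw (interleave x x') =
      ((W.blockLaw x).prod (W.blockLaw x')).map fun y => interleave y.1 y.2 := by
  refine Measure.pi_eq fun s hs => ?_
  rw [Measure.map_apply measurable_interleave (MeasurableSet.univ_pi hs)]
  have : (fun y : (Fin (2 ^ n) → Y) × (Fin (2 ^ n) → Y) => interleave y.1 y.2) ⁻¹'
      (Set.univ.pi s) = (Set.univ.pi fun a => s (pairIndex n (a, 0))) ×ˢ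
        (Set.univ.pi fun a => s (pairIndex n (a, 1))) := by
    ext y
    simp only [Set.mem_preimage, Set.mem_univ_pi, Set.mem_prod]
    rw [forall_pairIndex]
    simp [forall_and]
  rw [this, Measure.prod_prod, blockLaw, blockLaw, Measure.pi_pi, Measure.pi_pi, prod_pairIndex]
  simp

/-- The output of a block almost surely has a positive likelihood under the word that was sent. -/
lemma ae_prod_pos {n : ℕ} (x : Fin (2 ^ n) → ZMod 2) :
    ∀ᵐ y ∂(W.blockLaw x), 0 < ∏ j, W.p (x j) (y j) := by
  have h : ∀ j, ∀ᵐ y ∂(W.blockLaw x), 0 < W.p (x j) (y j) := by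
    intro j
    have hj : ∀ᵐ y ∂(W.outputLaw (x j)), 0 < W.p (x j) y := by
      rw [outputLaw, ae_withDensity_iff (W.measurable_p _).ennreal_ofReal]
      exact ae_of_all _ fun y hy => by simpa using hy
    exact (Measure.tendsto_eval_ae_ae (μ := fun j => W.outputLaw (x j)) (i := j)).eventually hj
  filter_upwards [ae_all_iff.2 h] with y hy
  exact Finset.prod_pos fun j _ => hy j

/-! ### Posterior probabilities of the split channels -/

/-- The likelihood of the output `y` and of the bits of `u` before the `i`-th, when the `i`-th bit
is `b`, without the normalization of `splitProb`. -/
def splitLikelihood {n : ℕ} (y : Fin (2 ^ n) → Y) (u : Fin (2 ^ n) → ZMod 2) (i : Fin (2 ^ n))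
    (b : ZMod 2) : ℝ :=
  ∑ v : Fin (2 ^ n) → ZMod 2, if (∀ j < i, v j = u j) ∧ v i = b then
    ∏ j, W.p (Matrix.vecMul v (polarMatrix n) j) (y j) else 0

lemma splitProb_eq {n : ℕ} (y : Fin (2 ^ n) → Y) (u : Fin (2 ^ n) → ZMod 2) (i : Fin (2 ^ n))
    (past : (j : Fin (2 ^ n)) → j < i → ZMod 2) (hpast : ∀ j h, past j h = u j) (b : ZMod 2) :
    W.splitProb y i past b = 1 / 2 ^ (2 ^ n - 1) * W.splitLikelihood y u i b := by
  simp only [splitProb, splitLikelihood, hpast, ← Finset.mul_sum, Finset.sum_filter]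

lemma prod_nonneg {n : ℕ} (x : Fin (2 ^ n) → ZMod 2) (y : Fin (2 ^ n) → Y) :
    0 ≤ ∏ j, W.p (x j) (y j) :=
  Finset.prod_nonneg fun _ _ => W.nonneg _ _

lemma splitLikelihood_nonneg {n : ℕ} (y : Fin (2 ^ n) → Y) (u : Fin (2 ^ n) → ZMod 2)
    (i : Fin (2 ^ n)) (b : ZMod 2) : 0 ≤ W.splitLikelihood y u i b :=
  Finset.sum_nonneg fun v _ => by
    split_ifs
    exacts [W.prod_nonneg _ _, le_rfl]

lemma splitLikelihood_pos {n : ℕ} {y : Fin (2 ^ n) → Y} {u : Fin (2 ^ n) → ZMod 2}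
    (h : 0 < ∏ j, W.p (Matrix.vecMul u (polarMatrix n) j) (y j)) (i : Fin (2 ^ n)) :
    0 < W.splitLikelihood y u i (u i) := by
  refine lt_of_lt_of_le h ?_
  have := Finset.single_le_sum (s := Finset.univ) (f := fun v : Fin (2 ^ n) → ZMod 2 =>
    if (∀ j < i, v j = u j) ∧ v i = u i then
      ∏ j, W.p (Matrix.vecMul v (polarMatrix n) j) (y j) else 0)
    (fun v _ => by
      split_ifs
      exacts [W.prod_nonneg _ _, le_rfl]) (Finset.mem_univ u)
  simpa [splitLikelihood] using this

lemma splitLikelihood_total_pos {n : ℕ} {y : Fin (2 ^ n) → Y} {u : Fin (2 ^ n) → ZMod 2}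
    (h : 0 < ∏ j, W.p (Matrix.vecMul u (polarMatrix n) j) (y j)) (i : Fin (2 ^ n)) :
    0 < W.splitLikelihood y u i 0 + W.splitLikelihood y u i 1 := by
  have h1 := W.splitLikelihood_pos h i
  have h2 := W.splitLikelihood_nonneg y u i 0
  have h3 := W.splitLikelihood_nonneg y u i 1
  rcases zmod_two_eq_zero_or_one (u i) with h4 | h4 <;> rw [h4] at h1 <;> linarith

@[fun_prop]
lemma measurable_splitLikelihood {n : ℕ} (u : Fin (2 ^ n) → ZMod 2) (i : Fin (2 ^ n))
    (b : ZMod 2) : Measurable fun y : Fin (2 ^ n) → Y => W.splitLikelihood y u i b := by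
  unfold splitLikelihood
  refine Finset.measurable_fun_sum _ fun v _ => ?_
  split_ifs
  · exact Finset.measurable_fun_prod _ fun j _ => (W.measurable_p _).comp (measurable_pi_apply j)
  · exact measurable_const

lemma prod_interleave {n : ℕ} (v v' : Fin (2 ^ n) → ZMod 2) (y y' : Fin (2 ^ n) → Y) :
    ∏ j, W.p (Matrix.vecMul (polarStep n (v, v')) (polarMatrix (n + 1)) j) (interleave y y' j) =
      (∏ j, W.p (Matrix.vecMul v (polarMatrix n) j) (y j)) *
        ∏ j, W.p (Matrix.vecMul v' (polarMatrix n) j) (y' j) := by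
  rw [vecMul_polarStep, prod_pairIndex]
  simp

lemma polarStep_prefix_iff {n : ℕ} (v v' u u' : Fin (2 ^ n) → ZMod 2) (i : Fin (2 ^ n)) :
    (∀ j < pairIndex n (i, 0), polarStep n (v, v') j = polarStep n (u, u') j) ↔
      (∀ j < i, v j = u j) ∧ ∀ j < i, v' j = u' j := by
  rw [forall_pairIndex]
  simp only [pairIndex_lt_iff, polarStep_pairIndex_zero, polarStep_pairIndex_one, lt_self_iff_false,
    and_false, or_false, Fin.not_lt_zero]
  constructor
  · intro h
    refine ⟨fun j hj => ?_, fun j hj => (h j).2 hj⟩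
    have := (h j).1 hj
    rwa [(h j).2 hj, add_left_inj] at this
  · exact fun h a => ⟨fun ha => by rw [h.1 a ha, h.2 a ha], fun ha => h.2 a ha⟩

lemma polarStep_prefix_iff' {n : ℕ} (v v' u u' : Fin (2 ^ n) → ZMod 2) (i : Fin (2 ^ n)) :
    (∀ j < pairIndex n (i, 1), polarStep n (v, v') j = polarStep n (u, u') j) ↔
      ((∀ j < i, v j = u j) ∧ ∀ j < i, v' j = u' j) ∧ v i + v' i = u i + u' i := by
  rw [← polarStep_prefix_iff, ← polarStep_pairIndex_zero, ← polarStep_pairIndex_zero]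
  have hlt : ∀ j, j < pairIndex n (i, 1) ↔ j < pairIndex n (i, 0) ∨ j = pairIndex n (i, 0) := by
    intro j
    simp only [Fin.lt_def, Fin.ext_iff, pairIndex_val, Fin.val_zero, Fin.val_one]
    omega
  simp only [hlt, or_imp, forall_and, forall_eq]

lemma ite_sum_eq (P Q : Prop) (r r' b : ZMod 2) (A B : ℝ) [Decidable ((P ∧ Q) ∧ r + r' = b)]
    [Decidable (P ∧ r = b + 0)] [Decidable (P ∧ r = b + 1)] [Decidable (Q ∧ r' = 0)]
    [Decidable (Q ∧ r' = 1)] :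
    (if (P ∧ Q) ∧ r + r' = b then A * B else 0) =
      (if P ∧ r = b + 0 then A else 0) * (if Q ∧ r' = 0 then B else 0) +
        (if P ∧ r = b + 1 then A else 0) * (if Q ∧ r' = 1 then B else 0) := by
  have h1 : ∀ r b : ZMod 2, r = b + 1 ↔ r + 1 = b := by decide
  rcases zmod_two_eq_zero_or_one r' with rfl | rfl <;> by_cases hP : P <;> by_cases hQ : Q <;>
    simp [hP, hQ, h1]

lemma ite_pair_eq (P Q : Prop) (r r' s b : ZMod 2) (A B : ℝ)
    [Decidable (((P ∧ Q) ∧ r + r' = s) ∧ r' = b)] [Decidable (P ∧ r = s + b)]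
    [Decidable (Q ∧ r' = b)] :
    (if ((P ∧ Q) ∧ r + r' = s) ∧ r' = b then A * B else 0) =
      (if P ∧ r = s + b then A else 0) * (if Q ∧ r' = b then B else 0) := by
  have h : ∀ r s b : ZMod 2, r = s + b ↔ r + b = s := by decide
  by_cases hb : r' = b
  · subst hb
    by_cases hP : P <;> by_cases hQ : Q <;> simp [hP, hQ, h]
  · simp [hb]

/-- The minus transform of the split channels. -/
lemma splitLikelihood_pairIndex_zero {n : ℕ} (y y' : Fin (2 ^ n) → Y)
    (u u' : Fin (2 ^ n) → ZMod 2) (i : Fin (2 ^ n)) (b : ZMod 2) :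
    W.splitLikelihood (interleave y y') (polarStep n (u, u')) (pairIndex n (i, 0)) b =
      ∑ c, W.splitLikelihood y u i (b + c) * W.splitLikelihood y' u' i c := by
  simp only [sum_zmod_two, splitLikelihood, Finset.sum_mul_sum, ← Finset.sum_add_distrib]
  rw [← (polarStep n).sum_comp, Fintype.sum_prod_type]
  refine Finset.sum_congr rfl fun v _ => Finset.sum_congr rfl fun v' _ => ?_
  simp only [polarStep_prefix_iff, prod_interleave, polarStep_pairIndex_zero]
  exact ite_sum_eq _ _ _ _ _ _ _

/-- The plus transform of the split channels. -/
lemma splitLikelihood_pairIndex_one {n : ℕ} (y y' : Fin (2 ^ n) → Y)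
    (u u' : Fin (2 ^ n) → ZMod 2) (i : Fin (2 ^ n)) (b : ZMod 2) :
    W.splitLikelihood (interleave y y') (polarStep n (u, u')) (pairIndex n (i, 1)) b =
      W.splitLikelihood y u i (u i + u' i + b) * W.splitLikelihood y' u' i b := by
  simp only [splitLikelihood, Finset.sum_mul_sum]
  rw [← (polarStep n).sum_comp, Fintype.sum_prod_type]
  refine Finset.sum_congr rfl fun v _ => Finset.sum_congr rfl fun v' _ => ?_
  simp only [polarStep_prefix_iff', prod_interleave, polarStep_pairIndex_one]
  exact ite_pair_eq _ _ _ _ _ _ _ _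

end BinaryInputChannel

/-- The posterior probability of the bit `1` under a uniform prior, from the likelihoods of the
two bits. The projection to the unit interval acts trivially; the value is irrelevant if both
likelihoods vanish. -/
def ratioPosterior (x : ZMod 2 → ℝ) : 𝕀 :=
  Set.projIcc 0 1 zero_le_one (x 1 / (x 0 + x 1))

lemma ratioPosterior_eq {x : ZMod 2 → ℝ} {T : ℝ} (hT : 0 < T) {a : 𝕀}
    (h : ∀ b, x b = T * bitWeight a b) : ratioPosterior x = a := by
  have : x 1 / (x 0 + x 1) = a := by
    rw [h 0, h 1, bitWeight_zero, bitWeight_one]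
    field_simp
    ring
  rw [ratioPosterior, this, Set.projIcc_val]

lemma mul_bitWeight_ratioPosterior {x : ZMod 2 → ℝ} (hx : ∀ b, 0 ≤ x b) (b : ZMod 2) :
    (x 0 + x 1) * bitWeight (ratioPosterior x) b = x b := by
  have h0 := hx 0
  have h1 := hx 1
  rcases (add_nonneg h0 h1).eq_or_lt with hT | hT
  · rw [← hT, zero_mul]
    rcases zmod_two_eq_zero_or_one b with rfl | rfl <;> linarith
  · have hm : x 1 / (x 0 + x 1) ∈ Set.Icc (0 : ℝ) 1 :=
      ⟨by positivity, (div_le_one hT).2 (by linarith)⟩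
    have hval : (ratioPosterior x : ℝ) = x 1 / (x 0 + x 1) := by
      unfold ratioPosterior
      rw [Set.projIcc_of_mem zero_le_one hm]
    rcases zmod_two_eq_zero_or_one b with rfl | rfl
    · rw [bitWeight_zero, hval, mul_sub, mul_div_cancel₀ _ hT.ne']; ring
    · rw [bitWeight_one, hval, mul_div_cancel₀ _ hT.ne']

lemma measurable_ratioPosterior {Ω : Type*} [MeasurableSpace Ω] {f : Ω → ZMod 2 → ℝ}
    (hf : ∀ b, Measurable fun ω => f ω b) : Measurable fun ω => ratioPosterior (f ω) :=
  continuous_projIcc.measurable.comp ((hf 1).div ((hf 0).add (hf 1)))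

/-- The sequence of transforms that leads to the split channel of an index: its binary digits,
the most significant one first. -/
def indexPath : (n : ℕ) → Fin (2 ^ n) → List Bool
  | 0, _ => []
  | n + 1, k => indexPath n ((pairIndex n).symm k).1 ++ [decide (((pairIndex n).symm k).2 = 1)]

lemma indexPath_pairIndex_zero {n : ℕ} (i : Fin (2 ^ n)) :
    indexPath (n + 1) (pairIndex n (i, 0)) = indexPath n i ++ [false] := by
  simp [indexPath]

lemma indexPath_pairIndex_one {n : ℕ} (i : Fin (2 ^ n)) :
    indexPath (n + 1) (pairIndex n (i, 1)) = indexPath n i ++ [true] := by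
  simp [indexPath]

lemma sum_indexPath (n : ℕ) (g : List Bool → ℝ) :
    ∑ i, g (indexPath n i) = 2 ^ n * bitAverage n g := by
  induction n generalizing g with
  | zero => simp [indexPath, bitAverage]
  | succ n ih =>
    rw [bitAverage_succ_last, sum_pairIndex]
    simp only [indexPath_pairIndex_zero, indexPath_pairIndex_one]
    rw [ih fun w => g (w ++ [false]), ih fun w => g (w ++ [true]), ← mul_add, ← bitAverage_add]
    have : bitAverage n (fun v => (g (v ++ [false]) + g (v ++ [true])) / 2) =
        1 / 2 * bitAverage n (fun v => g (v ++ [false]) + g (v ++ [true])) := by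
      rw [← bitAverage_const_mul]; congr 1; ext w; ring
    rw [this]; ring

lemma lintegral_sum_const_mul {ι Ω : Type*} [Fintype ι] [MeasurableSpace Ω] {P : Measure Ω}
    (k : ι → ENNReal) {f : ι → Ω → ENNReal} (hf : ∀ d, Measurable (f d)) :
    ∫⁻ a, ∑ d, k d * f d a ∂P = ∑ d, k d * ∫⁻ a, f d a ∂P := by
  rw [lintegral_finsetSum _ fun d _ => (hf d).const_mul _]
  exact Finset.sum_congr rfl fun d _ => lintegral_const_mul _ (hf d)

namespace BinaryInputChannel

variable {Y : Type*} [MeasurableSpace Y] {μ : Measure Y} (W : BinaryInputChannel Y μ)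

/-- The posterior probability that the `i`-th bit is `1`, given the output `y` and the bits of `u`
before the `i`-th. -/
def posterior {n : ℕ} (y : Fin (2 ^ n) → Y) (u : Fin (2 ^ n) → ZMod 2) (i : Fin (2 ^ n)) : 𝕀 :=
  ratioPosterior (W.splitLikelihood y u i)

@[fun_prop]
lemma measurable_posterior {n : ℕ} (u : Fin (2 ^ n) → ZMod 2) (i : Fin (2 ^ n)) :
    Measurable fun y : Fin (2 ^ n) → Y => W.posterior y u i :=
  measurable_ratioPosterior fun b => W.measurable_splitLikelihood u i b

lemma posterior_pairIndex_zero {n : ℕ} {y y' : Fin (2 ^ n) → Y} {u u' : Fin (2 ^ n) → ZMod 2}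
    (h : 0 < ∏ j, W.p (Matrix.vecMul u (polarMatrix n) j) (y j))
    (h' : 0 < ∏ j, W.p (Matrix.vecMul u' (polarMatrix n) j) (y' j)) (i : Fin (2 ^ n)) :
    W.posterior (interleave y y') (polarStep n (u, u')) (pairIndex n (i, 0)) =
      sumPosterior (W.posterior y u i) (W.posterior y' u' i) := by
  refine ratioPosterior_eq (mul_pos (W.splitLikelihood_total_pos h i)
    (W.splitLikelihood_total_pos h' i)) fun b => ?_
  rw [splitLikelihood_pairIndex_zero, bitWeight_sumPosterior, Finset.mul_sum]
  refine Finset.sum_congr rfl fun c _ => ?_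
  rw [mul_mul_mul_comm, posterior, posterior,
    mul_bitWeight_ratioPosterior (W.splitLikelihood_nonneg y u i),
    mul_bitWeight_ratioPosterior (W.splitLikelihood_nonneg y' u' i)]

lemma bitWeight_posterior_pos {n : ℕ} {y : Fin (2 ^ n) → Y} {u : Fin (2 ^ n) → ZMod 2}
    (h : 0 < ∏ j, W.p (Matrix.vecMul u (polarMatrix n) j) (y j)) (i : Fin (2 ^ n)) :
    0 < bitWeight (W.posterior y u i) (u i) := by
  have := W.splitLikelihood_pos h i
  rw [← mul_bitWeight_ratioPosterior (W.splitLikelihood_nonneg y u i)] at this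
  exact pos_of_mul_pos_right this (W.splitLikelihood_total_pos h i).le

lemma posterior_pairIndex_one {n : ℕ} {y y' : Fin (2 ^ n) → Y} {u u' : Fin (2 ^ n) → ZMod 2}
    (h : 0 < ∏ j, W.p (Matrix.vecMul u (polarMatrix n) j) (y j))
    (h' : 0 < ∏ j, W.p (Matrix.vecMul u' (polarMatrix n) j) (y' j)) (i : Fin (2 ^ n)) :
    W.posterior (interleave y y') (polarStep n (u, u')) (pairIndex n (i, 1)) =
      condPosterior (u i + u' i) (W.posterior y u i) (W.posterior y' u' i) := by
  have hs : 0 < bitWeight (sumPosterior (W.posterior y u i) (W.posterior y' u' i))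
      (u i + u' i) := by
    have := mul_pos (W.bitWeight_posterior_pos h i) (W.bitWeight_posterior_pos h' i)
    have e := bitWeight_mul_condPosterior (u i + u' i) (u' i) (W.posterior y u i)
      (W.posterior y' u' i)
    rw [add_assoc, CharTwo.add_self_eq_zero, add_zero] at e
    rw [← e] at this
    exact pos_of_mul_pos_left this (bitWeight_nonneg _ _)
  refine ratioPosterior_eq (mul_pos (mul_pos (W.splitLikelihood_total_pos h i)
    (W.splitLikelihood_total_pos h' i)) hs) fun b => ?_
  rw [splitLikelihood_pairIndex_one, mul_assoc _ (bitWeight _ _), bitWeight_mul_condPosterior,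
    mul_mul_mul_comm, posterior, posterior,
    mul_bitWeight_ratioPosterior (W.splitLikelihood_nonneg y u i),
    mul_bitWeight_ratioPosterior (W.splitLikelihood_nonneg y' u' i)]

/-- The posterior law of the channel itself: the law of the posterior probability of the input `1`
when the input is uniformly distributed. -/
def initialLaw : Measure 𝕀 :=
  (2⁻¹ : ENNReal) • ∑ x, (W.outputLaw x).map fun y => ratioPosterior fun c => W.p c y

@[fun_prop]
lemma measurable_initialPosterior : Measurable fun y => ratioPosterior fun c => W.p c y :=
  measurable_ratioPosterior W.measurable_p

instance isProbabilityMeasure_initialLaw : IsProbabilityMeasure W.initialLaw := by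
  constructor
  rw [initialLaw, sum_zmod_two, Measure.smul_apply, Measure.add_apply,
    Measure.map_apply W.measurable_initialPosterior MeasurableSet.univ,
    Measure.map_apply W.measurable_initialPosterior MeasurableSet.univ]
  simp [one_add_one_eq_two, ENNReal.inv_mul_cancel]

lemma lintegral_initialLaw {g : 𝕀 → ENNReal} (hg : Measurable g) :
    2 * ∫⁻ a, g a ∂W.initialLaw =
      ∑ x, ∫⁻ y, g (ratioPosterior fun c => W.p c y) ∂(W.outputLaw x) := by
  rw [initialLaw, lintegral_smul_measure, smul_eq_mul, ← mul_assoc,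
    ENNReal.mul_inv_cancel two_ne_zero ENNReal.ofNat_ne_top, one_mul, lintegral_finsetSum_measure]
  exact Finset.sum_congr rfl fun x _ => lintegral_map hg W.measurable_initialPosterior

lemma measurable_sum_bitWeight_mul {ψ : ZMod 2 → 𝕀 → ENNReal} (hψ : ∀ c, Measurable (ψ c)) :
    Measurable fun a => ∑ c, ENNReal.ofReal (bitWeight a c) * ψ c a :=
  Finset.measurable_fun_sum _ fun c _ =>
    (continuous_bitWeight c).measurable.ennreal_ofReal.mul (hψ c)

lemma sum_lintegral_initialPosterior {ψ : ZMod 2 → 𝕀 → ENNReal} (hψ : ∀ c, Measurable (ψ c)) :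
    ∑ x, ∫⁻ y, ψ x (ratioPosterior fun c => W.p c y) ∂(W.outputLaw x) =
      2 * ∫⁻ a, ∑ c, ENNReal.ofReal (bitWeight a c) * ψ c a ∂W.initialLaw := by
  have hm := measurable_sum_bitWeight_mul hψ
  have hp := W.measurable_initialPosterior
  have hmp : ∀ x, Measurable fun y => ENNReal.ofReal (W.p x y) :=
    fun x => (W.measurable_p x).ennreal_ofReal
  rw [W.lintegral_initialLaw hm]
  have e1 : ∀ x, ∫⁻ y, ψ x (ratioPosterior fun c => W.p c y) ∂(W.outputLaw x) =
      ∫⁻ y, ENNReal.ofReal (W.p x y) * ψ x (ratioPosterior fun c => W.p c y) ∂μ :=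
    fun x => W.lintegral_outputLaw x ((hψ x).comp hp)
  have e2 : ∀ x, ∫⁻ y, ∑ c, ENNReal.ofReal (bitWeight (ratioPosterior fun c => W.p c y) c) *
        ψ c (ratioPosterior fun c => W.p c y) ∂(W.outputLaw x) =
      ∫⁻ y, ENNReal.ofReal (W.p x y) * ∑ c,
        ENNReal.ofReal (bitWeight (ratioPosterior fun c => W.p c y) c) *
        ψ c (ratioPosterior fun c => W.p c y) ∂μ :=
    fun x => W.lintegral_outputLaw x (hm.comp hp)
  simp only [e1, e2]
  have m1 : ∀ x, Measurable fun y =>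
      ENNReal.ofReal (W.p x y) * ψ x (ratioPosterior fun c => W.p c y) :=
    fun x => (hmp x).mul ((hψ x).comp hp)
  have m2 : ∀ x, Measurable fun y => ENNReal.ofReal (W.p x y) * ∑ c,
      ENNReal.ofReal (bitWeight (ratioPosterior fun c => W.p c y) c) *
        ψ c (ratioPosterior fun c => W.p c y) :=
    fun x => (hmp x).mul (hm.comp hp)
  rw [← lintegral_finsetSum _ fun x _ => m1 x, ← lintegral_finsetSum _ fun x _ => m2 x]
  congr 1
  ext y
  rw [← Finset.sum_mul, Finset.mul_sum, sum_zmod_two fun x => ENNReal.ofReal (W.p x y),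
    ← ENNReal.ofReal_add (W.nonneg 0 y) (W.nonneg 1 y)]
  refine Finset.sum_congr rfl fun c _ => ?_
  rw [← mul_assoc, ← ENNReal.ofReal_mul (add_nonneg (W.nonneg 0 y) (W.nonneg 1 y)),
    mul_bitWeight_ratioPosterior fun c => W.nonneg c y]

/-- A statement on the joint law of a bit and its posterior probability extends from a block to a
pair of independent blocks. -/
lemma sum_lintegral_pair {n : ℕ} {i : Fin (2 ^ n)} {D : Measure 𝕀} [IsProbabilityMeasure D]
    {M : ENNReal}
    (hD : ∀ ψ : ZMod 2 → 𝕀 → ENNReal, (∀ c, Measurable (ψ c)) →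
      ∑ u : Fin (2 ^ n) → ZMod 2, ∫⁻ y, ψ (u i) (W.posterior y u i)
        ∂(W.blockLaw (Matrix.vecMul u (polarMatrix n))) =
      M * ∫⁻ a, ∑ c, ENNReal.ofReal (bitWeight a c) * ψ c a ∂D)
    {ψ : ZMod 2 → ZMod 2 → 𝕀 × 𝕀 → ENNReal} (hψ : ∀ c d, Measurable (ψ c d)) :
    ∑ u : Fin (2 ^ n) → ZMod 2, ∑ u' : Fin (2 ^ n) → ZMod 2,
      ∫⁻ y, ψ (u i) (u' i) (W.posterior y.1 u i, W.posterior y.2 u' i)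
        ∂((W.blockLaw (Matrix.vecMul u (polarMatrix n))).prod
          (W.blockLaw (Matrix.vecMul u' (polarMatrix n)))) =
      M * M * ∫⁻ p, ∑ d, ∑ c, ENNReal.ofReal (bitWeight p.2 d) *
        (ENNReal.ofReal (bitWeight p.1 c) * ψ c d p) ∂(D.prod D) := by
  have hmw : ∀ c, Measurable fun a : 𝕀 => ENNReal.ofReal (bitWeight a c) :=
    fun c => (continuous_bitWeight c).measurable.ennreal_ofReal
  have hmΦ : ∀ d, Measurable fun p : 𝕀 × 𝕀 =>
      ∑ c, ENNReal.ofReal (bitWeight p.1 c) * ψ c d p := fun d =>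
    Finset.measurable_fun_sum _ fun c _ => ((hmw c).comp measurable_fst).mul (hψ c d)
  -- for a fixed second block, the hypothesis applies to the first one
  have hinner : ∀ (u' : Fin (2 ^ n) → ZMod 2), ∑ u : Fin (2 ^ n) → ZMod 2,
      ∫⁻ y, ψ (u i) (u' i) (W.posterior y.1 u i, W.posterior y.2 u' i)
        ∂((W.blockLaw (Matrix.vecMul u (polarMatrix n))).prod
          (W.blockLaw (Matrix.vecMul u' (polarMatrix n)))) =
      ∫⁻ y', M * ∫⁻ a, ∑ c, ENNReal.ofReal (bitWeight a c) *
        ψ c (u' i) (a, W.posterior y' u' i) ∂D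
          ∂(W.blockLaw (Matrix.vecMul u' (polarMatrix n))) := by
    intro u'
    have hm : ∀ u : Fin (2 ^ n) → ZMod 2, Measurable
        fun y : (Fin (2 ^ n) → Y) × (Fin (2 ^ n) → Y) =>
          ψ (u i) (u' i) (W.posterior y.1 u i, W.posterior y.2 u' i) := fun u =>
      (hψ _ _).comp (((W.measurable_posterior u i).comp measurable_fst).prodMk
        ((W.measurable_posterior u' i).comp measurable_snd))
    simp only [lintegral_prod_symm' _ (hm _)]
    rw [← lintegral_finsetSum _ fun u _ => (hm u).lintegral_prod_left']
    congr 1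
    ext y'
    exact hD (fun c a => ψ c (u' i) (a, W.posterior y' u' i))
      fun c => (hψ c _).comp (measurable_id.prodMk measurable_const)
  rw [Finset.sum_comm]
  simp only [hinner]
  rw [hD (fun d b => M * ∫⁻ a, ∑ c, ENNReal.ofReal (bitWeight a c) * ψ c d (a, b) ∂D)
    fun d => ((hmΦ d).lintegral_prod_left').const_mul _]
  have hm' : Measurable fun p : 𝕀 × 𝕀 => ∑ d, ∑ c, ENNReal.ofReal (bitWeight p.2 d) *
      (ENNReal.ofReal (bitWeight p.1 c) * ψ c d p) :=
    Finset.measurable_fun_sum _ fun d _ => Finset.measurable_fun_sum _ fun c _ =>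
      ((hmw d).comp measurable_snd).mul (((hmw c).comp measurable_fst).mul (hψ c d))
  rw [lintegral_prod_symm' _ hm', mul_assoc,
    ← lintegral_const_mul _ hm'.lintegral_prod_left']
  congr 2
  ext b
  have hms : ∀ d, Measurable fun a : 𝕀 => ∑ c, ENNReal.ofReal (bitWeight a c) * ψ c d (a, b) :=
    fun d => Finset.measurable_fun_sum _ fun c _ =>
      (hmw c).mul ((hψ c d).comp (measurable_id.prodMk measurable_const))
  simp only [← Finset.mul_sum]
  rw [lintegral_sum_const_mul _ hms, Finset.mul_sum]
  exact Finset.sum_congr rfl fun d _ => mul_left_comm _ _ _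

/-- The joint law of a uniformly distributed bit and its posterior probability, given the output
and the preceding bits, is described by the posterior law along the path of the index. -/
theorem sum_lintegral_posterior {n : ℕ} (i : Fin (2 ^ n)) {ψ : ZMod 2 → 𝕀 → ENNReal}
    (hψ : ∀ c, Measurable (ψ c)) :
    ∑ u : Fin (2 ^ n) → ZMod 2, ∫⁻ y, ψ (u i) (W.posterior y u i)
        ∂(W.blockLaw (Matrix.vecMul u (polarMatrix n))) =
      2 ^ 2 ^ n * ∫⁻ a, ∑ c, ENNReal.ofReal (bitWeight a c) * ψ c a
        ∂(iteratedLaw W.initialLaw (indexPath n i)) := by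
  induction n generalizing ψ with
  | zero =>
    have : Unique (Fin (2 ^ 0)) := inferInstanceAs (Unique (Fin 1))
    have hvec : ∀ u : Fin (2 ^ 0) → ZMod 2, Matrix.vecMul u (polarMatrix 0) = u :=
      fun u => Matrix.vecMul_one u
    have hpost : ∀ (y : Fin (2 ^ 0) → Y) u, W.posterior y u i =
        ratioPosterior fun c => W.p c (y i) := by
      intro y u
      unfold posterior
      congr 1
      ext b
      have hlt : ∀ j, ¬ j < i := fun j hj => absurd (Subsingleton.elim j i) hj.ne
      simp only [splitLikelihood, hvec, hlt, false_imp_iff, implies_true, true_and]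
      rw [← (Equiv.funUnique (Fin (2 ^ 0)) (ZMod 2)).symm.sum_comp]
      simp only [Subsingleton.elim i default, Equiv.funUnique_symm_apply, uniqueElim_const,
        Finset.univ_unique, Finset.prod_singleton, Finset.sum_ite_eq', Finset.mem_univ, if_true]
      simp
      exact congrArg (fun k => W.p b (y k)) (Subsingleton.elim _ _)
    have hlaw : ∀ u : Fin (2 ^ 0) → ZMod 2, ∫⁻ y, ψ (u i) (W.posterior y u i)
        ∂(W.blockLaw (Matrix.vecMul u (polarMatrix 0))) =
        ∫⁻ y, ψ (u i) (ratioPosterior fun c => W.p c y) ∂(W.outputLaw (u i)) := by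
      intro u
      simp only [hpost, hvec]
      exact (measurePreserving_eval (fun j => W.outputLaw (u j)) i).lintegral_comp
        ((hψ _).comp W.measurable_initialPosterior)
    simp only [hlaw]
    rw [← (Equiv.funUnique (Fin (2 ^ 0)) (ZMod 2)).symm.sum_comp]
    simpa [indexPath, iteratedLaw, Subsingleton.elim i default] using
      W.sum_lintegral_initialPosterior hψ
  | succ n ih =>
    have hmw : ∀ c, Measurable fun a : 𝕀 => ENNReal.ofReal (bitWeight a c) :=
      fun c => (continuous_bitWeight c).measurable.ennreal_ofReal
    have hsplit : ∀ (k : Fin (2 ^ (n + 1))), ∑ u : Fin (2 ^ (n + 1)) → ZMod 2,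
        ∫⁻ y, ψ (u k) (W.posterior y u k)
          ∂(W.blockLaw (Matrix.vecMul u (polarMatrix (n + 1)))) =
        ∑ u : Fin (2 ^ n) → ZMod 2, ∑ u' : Fin (2 ^ n) → ZMod 2,
          ∫⁻ y, ψ (polarStep n (u, u') k)
            (W.posterior (interleave y.1 y.2) (polarStep n (u, u')) k)
            ∂((W.blockLaw (Matrix.vecMul u (polarMatrix n))).prod
              (W.blockLaw (Matrix.vecMul u' (polarMatrix n)))) := by
      intro k
      rw [← (polarStep n).sum_comp, Fintype.sum_prod_type]
      refine Finset.sum_congr rfl fun u _ => Finset.sum_congr rfl fun u' _ => ?_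
      rw [vecMul_polarStep, blockLaw_interleave]
      exact lintegral_map ((hψ _).comp (W.measurable_posterior _ _)) measurable_interleave
    -- the formulas for the posterior probabilities hold where the likelihoods do not vanish
    have hae : ∀ u u' : Fin (2 ^ n) → ZMod 2,
        ∀ᵐ y ∂((W.blockLaw (Matrix.vecMul u (polarMatrix n))).prod
          (W.blockLaw (Matrix.vecMul u' (polarMatrix n)))),
          0 < ∏ j, W.p (Matrix.vecMul u (polarMatrix n) j) (y.1 j) ∧
          0 < ∏ j, W.p (Matrix.vecMul u' (polarMatrix n) j) (y.2 j) := fun u u' =>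
      (Measure.quasiMeasurePreserving_fst.ae (W.ae_prod_pos _)).and
        (Measure.quasiMeasurePreserving_snd.ae (W.ae_prod_pos _))
    obtain ⟨⟨i, b⟩, rfl⟩ := (pairIndex n).surjective i
    set D := iteratedLaw W.initialLaw (indexPath n i) with hDdef
    have hb : b = 0 ∨ b = 1 := by revert b; decide
    rw [hsplit]
    rcases hb with rfl | rfl
    · have h1 : ∀ u u' : Fin (2 ^ n) → ZMod 2,
          ∫⁻ y, ψ (polarStep n (u, u') (pairIndex n (i, 0)))
            (W.posterior (interleave y.1 y.2) (polarStep n (u, u')) (pairIndex n (i, 0)))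
            ∂((W.blockLaw (Matrix.vecMul u (polarMatrix n))).prod
              (W.blockLaw (Matrix.vecMul u' (polarMatrix n)))) =
          ∫⁻ y, ψ (u i + u' i) (sumPosterior (W.posterior y.1 u i) (W.posterior y.2 u' i))
            ∂((W.blockLaw (Matrix.vecMul u (polarMatrix n))).prod
              (W.blockLaw (Matrix.vecMul u' (polarMatrix n)))) := by
        intro u u'
        refine lintegral_congr_ae ?_
        filter_upwards [hae u u'] with y hy
        rw [W.posterior_pairIndex_zero hy.1 hy.2, polarStep_pairIndex_zero]
      simp only [h1]
      have h2 := W.sum_lintegral_pair (i := i) (D := D) (fun ψ hψ => ih i hψ)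
        (ψ := fun c d p => ψ (c + d) (sumPosterior p.1 p.2))
        (fun c d => (hψ _).comp continuous_sumPosterior.measurable)
      rw [h2, ← pow_add, ← two_mul, ← pow_succ', indexPath_pairIndex_zero,
        iteratedLaw_append, ← hDdef]
      simp only [iteratedLaw]
      rw [lintegral_minusLaw _ (measurable_sum_bitWeight_mul hψ)]
      congr 2
      ext ⟨a, b⟩
      simp only [bitWeight_sumPosterior, sum_zmod_two]
      simp only [add_zero, zero_add, show (1 : ZMod 2) + 1 = 0 from rfl]
      rw [ENNReal.ofReal_add, ENNReal.ofReal_add, ENNReal.ofReal_mul, ENNReal.ofReal_mul,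
        ENNReal.ofReal_mul, ENNReal.ofReal_mul]
      · ring
      all_goals simp only [bitWeight_nonneg, mul_nonneg]
    · have h1 : ∀ u u' : Fin (2 ^ n) → ZMod 2,
          ∫⁻ y, ψ (polarStep n (u, u') (pairIndex n (i, 1)))
            (W.posterior (interleave y.1 y.2) (polarStep n (u, u')) (pairIndex n (i, 1)))
            ∂((W.blockLaw (Matrix.vecMul u (polarMatrix n))).prod
              (W.blockLaw (Matrix.vecMul u' (polarMatrix n)))) =
          ∫⁻ y, ψ (u' i)
            (condPosterior (u i + u' i) (W.posterior y.1 u i) (W.posterior y.2 u' i))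
            ∂((W.blockLaw (Matrix.vecMul u (polarMatrix n))).prod
              (W.blockLaw (Matrix.vecMul u' (polarMatrix n)))) := by
        intro u u'
        refine lintegral_congr_ae ?_
        filter_upwards [hae u u'] with y hy
        rw [W.posterior_pairIndex_one hy.1 hy.2, polarStep_pairIndex_one]
      simp only [h1]
      have h2 := W.sum_lintegral_pair (i := i) (D := D) (fun ψ hψ => ih i hψ)
        (ψ := fun c d p => ψ d (condPosterior (c + d) p.1 p.2))
        (fun c d => (hψ _).comp (measurable_condPosterior _))
      rw [h2, ← pow_add, ← two_mul, ← pow_succ', indexPath_pairIndex_one,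
        iteratedLaw_append, ← hDdef]
      simp only [iteratedLaw]
      rw [lintegral_plusLaw _ (measurable_sum_bitWeight_mul hψ)]
      congr 2
      ext ⟨a, b⟩
      have key : ∀ s d, ENNReal.ofReal (bitWeight (sumPosterior a b) s) *
          (ENNReal.ofReal (bitWeight (condPosterior s a b) d) * ψ d (condPosterior s a b)) =
          ENNReal.ofReal (bitWeight b d) * (ENNReal.ofReal (bitWeight a (s + d)) *
            ψ d (condPosterior s a b)) := by
        intro s d
        rw [← mul_assoc, ← mul_assoc, ← ENNReal.ofReal_mul (bitWeight_nonneg _ _),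
          ← ENNReal.ofReal_mul (bitWeight_nonneg _ _), bitWeight_mul_condPosterior,
          mul_comm (bitWeight b d)]
      simp only [Finset.mul_sum, key]
      simp only [sum_zmod_two]
      simp only [add_zero, zero_add, show (1 : ZMod 2) + 1 = 0 from rfl]
      ring
end BinaryInputChannel

namespace BinaryInputChannel

variable {Y : Type*} [MeasurableSpace Y] {μ : Measure Y} (W : BinaryInputChannel Y μ)

/-! ### The symmetric capacity -/

lemma integrable_p (x : ZMod 2) : Integrable (W.p x) μ :=
  ⟨(W.measurable_p x).aestronglyMeasurable, by
    rw [hasFiniteIntegral_iff_ofReal (ae_of_all _ (W.nonneg x)), W.lintegral_eq_one]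
    exact ENNReal.one_lt_top⟩

lemma integral_p (x : ZMod 2) : ∫ y, W.p x y ∂μ = 1 := by
  rw [integral_eq_lintegral_of_nonneg_ae (ae_of_all _ (W.nonneg x))
    (W.measurable_p x).aestronglyMeasurable, W.lintegral_eq_one, ENNReal.toReal_one]

lemma integral_outputLaw (x : ZMod 2) (g : Y → ℝ) :
    ∫ y, g y ∂(W.outputLaw x) = ∫ y, W.p x y * g y ∂μ := by
  rw [outputLaw, integral_withDensity_eq_integral_toReal_smul (W.measurable_p x).ennreal_ofReal
    (ae_of_all _ fun _ => ENNReal.ofReal_lt_top)]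
  simp [ENNReal.toReal_ofReal (W.nonneg x _)]

/-- The information density is one bit less the entropy of the posterior distribution. -/
lemma sum_informationDensity (y : Y) :
    ∑ x : ZMod 2, 1 / 2 * W.p x y * Real.logb 2 (W.p x y / (1 / 2 * W.p 0 y + 1 / 2 * W.p 1 y)) =
      ∑ x : ZMod 2, 1 / 2 * (W.p x y - W.p x y *
        (Real.binEntropy (ratioPosterior fun c => W.p c y) / Real.log 2)) := by
  set a := ratioPosterior fun c => W.p c y with ha
  have hx : ∀ x, W.p x y = (W.p 0 y + W.p 1 y) * bitWeight a x := fun x =>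
    (mul_bitWeight_ratioPosterior (x := fun c => W.p c y) (fun c => W.nonneg c y) x).symm
  set T := W.p 0 y + W.p 1 y with hT
  have hT0 : 0 ≤ T := add_nonneg (W.nonneg 0 y) (W.nonneg 1 y)
  have hden : 1 / 2 * W.p 0 y + 1 / 2 * W.p 1 y = T / 2 := by rw [hT]; ring
  have hl : Real.log 2 ≠ 0 := (Real.log_pos one_lt_two).ne'
  have hterm : ∀ x, 1 / 2 * W.p x y * Real.logb 2 (W.p x y / (T / 2)) =
      1 / 2 * (W.p x y - T * Real.negMulLog (bitWeight a x) / Real.log 2) := by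
    intro x
    rw [hx x]
    rcases hT0.eq_or_lt with h | h
    · simp [← h]
    rcases (bitWeight_nonneg a x).eq_or_lt with h' | h'
    · simp [← h']
    · rw [show T * bitWeight a x / (T / 2) = 2 * bitWeight a x by field_simp, Real.logb,
        Real.log_mul two_ne_zero h'.ne', Real.negMulLog]
      field_simp
      ring
  rw [hden]
  simp only [hterm, sum_zmod_two]
  rw [Real.binEntropy_eq_negMulLog_add_negMulLog_one_sub, bitWeight_zero, bitWeight_one]
  rw [show ∀ r : ℝ, 1 / 2 * (W.p 0 y - W.p 0 y * r) + 1 / 2 * (W.p 1 y - W.p 1 y * r) =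
    1 / 2 * (W.p 0 y + W.p 1 y) - 1 / 2 * T * r by intro r; rw [hT]; ring]
  ring

lemma symmetricCapacity_eq : W.symmetricCapacity = 1 - condEntropy W.initialLaw := by
  have hpost := W.measurable_initialPosterior
  have hg : ∀ x, Integrable (fun y => W.p x y *
      (Real.binEntropy (ratioPosterior fun c => W.p c y) / Real.log 2)) μ := by
    intro x
    refine (W.integrable_p x).mul_bdd (c := 1)
      (measurable_binEntropy_div.comp hpost).aestronglyMeasurable (ae_of_all _ fun y => ?_)
    rw [Real.norm_of_nonneg (binEntropy_div_mem _).1]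
    exact (binEntropy_div_mem _).2
  have h1 : condEntropy W.initialLaw = 1 / 2 * ∑ x : ZMod 2, ∫ y, W.p x y *
      (Real.binEntropy (ratioPosterior fun c => W.p c y) / Real.log 2) ∂μ := by
    have hprob : ∀ x, IsProbabilityMeasure
        ((W.outputLaw x).map fun y => ratioPosterior fun c => W.p c y) := fun x =>
      Measure.isProbabilityMeasure_map hpost.aemeasurable
    rw [condEntropy, initialLaw, integral_smul_measure,
      integral_finsetSum_measure fun x _ => integrable_binEntropy_div _]
    have : ∀ x, ∫ a : 𝕀, Real.binEntropy a / Real.log 2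
        ∂((W.outputLaw x).map fun y => ratioPosterior fun c => W.p c y) =
        ∫ y, W.p x y * (Real.binEntropy (ratioPosterior fun c => W.p c y) / Real.log 2) ∂μ := by
      intro x
      rw [integral_map hpost.aemeasurable measurable_binEntropy_div.aestronglyMeasurable,
        integral_outputLaw]
    simp only [this]
    simp
  rw [symmetricCapacity, h1]
  simp only [W.sum_informationDensity]
  have hi : ∀ x, Integrable (fun y => 1 / 2 * (W.p x y - W.p x y *
      (Real.binEntropy (ratioPosterior fun c => W.p c y) / Real.log 2))) μ := fun x =>
    ((W.integrable_p x).sub (hg x)).const_mul _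
  rw [integral_finsetSum _ fun x _ => hi x]
  simp only [integral_const_mul, integral_sub (W.integrable_p _) (hg _), integral_p, sum_zmod_two]
  ring

/-! ### Successive-cancellation decoding -/

/-- The Bhattacharyya parameter of the split channel with the index `i`. -/
def splitBhattacharyya (n : ℕ) (i : Fin (2 ^ n)) : ℝ :=
  bhattacharyya (iteratedLaw W.initialLaw (indexPath n i))

/-- The outputs for which the `i`-th bit of `u` is not strictly the more likely one, given the
true preceding bits. -/
def errorEvent {n : ℕ} (u : Fin (2 ^ n) → ZMod 2) (i : Fin (2 ^ n)) : Set (Fin (2 ^ n) → Y) :=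
  {y | W.splitLikelihood y u i (u i) ≤ W.splitLikelihood y u i (u i + 1)}

/-- The decoder recovers the input unless an error event occurs at an information index. -/
lemma scDecode_eq {n : ℕ} (c : PolarCode n) {u : Fin (2 ^ n) → ZMod 2} {y : Fin (2 ^ n) → Y}
    (hf : ∀ i ∉ c.infoSet, u i = c.frozen i) (hy : ∀ i ∈ c.infoSet, y ∉ W.errorEvent u i) :
    W.scDecode c y = u := by
  suffices h : ∀ m : ℕ, ∀ i : Fin (2 ^ n), i.val = m → W.scDecode c y i = u i from
    funext fun i => h _ i rfl
  intro m
  induction m using Nat.strong_induction_on with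
  | _ m ih =>
    intro i hi
    have hpast : ∀ j, j < i → W.scDecode c y j = u j := fun j hj => ih j.val (hi ▸ hj) j rfl
    rw [scDecode]
    split_ifs with h1 h2
    · rw [W.splitProb_eq y u i _ hpast, W.splitProb_eq y u i _ hpast,
        mul_le_mul_iff_right₀ (by positivity)] at h2
      rcases zmod_two_eq_zero_or_one (u i) with h | h
      · exact h.symm
      · refine absurd ?_ (hy i h1)
        simpa [errorEvent, h, show (1 : ZMod 2) + 1 = 0 from rfl] using h2
    · rw [W.splitProb_eq y u i _ hpast, W.splitProb_eq y u i _ hpast,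
        mul_le_mul_iff_right₀ (by positivity)] at h2
      rcases zmod_two_eq_zero_or_one (u i) with h | h
      · refine absurd ?_ (hy i h1)
        simpa [errorEvent, h] using (not_le.1 h2).le
      · exact h.symm
    · exact (hf i h1).symm

lemma sum_bitWeight_mul_ite_le (a : 𝕀) :
    ∑ c, ENNReal.ofReal (bitWeight a c) * (if bitWeight a c ≤ 1 / 2 then 1 else 0) ≤
      ENNReal.ofReal (bhattacharyyaFun a) := by
  have hsq : 0 ≤ √(bitWeight a 0 * bitWeight a 1) := Real.sqrt_nonneg _
  have hterm : ∀ c, ENNReal.ofReal (bitWeight a c) * (if bitWeight a c ≤ 1 / 2 then 1 else 0) ≤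
      ENNReal.ofReal √(bitWeight a 0 * bitWeight a 1) := by
    intro c
    split_ifs with h
    · rw [mul_one]
      refine ENNReal.ofReal_le_ofReal (Real.le_sqrt_of_sq_le ?_)
      have h0 := a.2.1
      have h1 := a.2.2
      rcases zmod_two_eq_zero_or_one c with rfl | rfl <;>
        simp only [bitWeight_zero, bitWeight_one] at h ⊢ <;> nlinarith
    · simp
  rw [sum_zmod_two, bhattacharyyaFun, two_mul, ENNReal.ofReal_add hsq hsq]
  exact add_le_add (hterm 0) (hterm 1)

/-- Under a uniformly distributed input, the probability of an error event is at most the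
Bhattacharyya parameter of the split channel. -/
lemma sum_blockLaw_errorEvent_le {n : ℕ} (i : Fin (2 ^ n)) :
    ∑ u : Fin (2 ^ n) → ZMod 2, (W.blockLaw (Matrix.vecMul u (polarMatrix n))).real
      (W.errorEvent u i) ≤ 2 ^ 2 ^ n * W.splitBhattacharyya n i := by
  let ψ : ZMod 2 → 𝕀 → ENNReal := fun c a => if bitWeight a c ≤ 1 / 2 then 1 else 0
  have hψ : ∀ c, Measurable (ψ c) := fun c =>
    Measurable.ite (measurableSet_le (continuous_bitWeight c).measurable measurable_const)
      measurable_const measurable_const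
  have h1 : ∀ u : Fin (2 ^ n) → ZMod 2,
      W.blockLaw (Matrix.vecMul u (polarMatrix n)) (W.errorEvent u i) ≤
        ∫⁻ y, ψ (u i) (W.posterior y u i) ∂(W.blockLaw (Matrix.vecMul u (polarMatrix n))) := by
    intro u
    have hmeas : MeasurableSet (W.errorEvent u i) :=
      measurableSet_le (W.measurable_splitLikelihood u i _) (W.measurable_splitLikelihood u i _)
    rw [← lintegral_indicator_one hmeas]
    refine lintegral_mono_ae ?_
    filter_upwards [W.ae_prod_pos (Matrix.vecMul u (polarMatrix n))] with y hy
    by_cases hye : y ∈ W.errorEvent u i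
    · have hT := W.splitLikelihood_total_pos hy i
      have hw : bitWeight (W.posterior y u i) (u i) ≤ 1 / 2 := by
        have hb := fun b => mul_bitWeight_ratioPosterior (W.splitLikelihood_nonneg y u i) b
        have hle : W.splitLikelihood y u i (u i) ≤ W.splitLikelihood y u i (u i + 1) := hye
        rw [← hb (u i), ← hb (u i + 1), mul_le_mul_iff_right₀ hT] at hle
        change bitWeight (W.posterior y u i) _ ≤ bitWeight (W.posterior y u i) _ at hle
        rcases zmod_two_eq_zero_or_one (u i) with h | h <;> rw [h] at hle ⊢
        · simp only [zero_add, bitWeight_zero, bitWeight_one] at hle ⊢; linarith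
        · simp only [show (1 : ZMod 2) + 1 = 0 from rfl, bitWeight_zero, bitWeight_one] at hle ⊢
          linarith
      simp only [Set.indicator_of_mem hye, ψ, if_pos hw, Pi.one_apply, le_refl]
    · rw [Set.indicator_of_notMem hye]; exact zero_le
  have h2 : ∑ u : Fin (2 ^ n) → ZMod 2,
      W.blockLaw (Matrix.vecMul u (polarMatrix n)) (W.errorEvent u i) ≤
        2 ^ 2 ^ n * ENNReal.ofReal (W.splitBhattacharyya n i) := by
    refine (Finset.sum_le_sum fun u _ => h1 u).trans ?_
    rw [W.sum_lintegral_posterior i hψ, splitBhattacharyya, bhattacharyya,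
      ofReal_integral_eq_lintegral_ofReal (integrable_bhattacharyyaFun _)
        (ae_of_all _ bhattacharyyaFun_nonneg)]
    gcongr
    exact sum_bitWeight_mul_ite_le _
  have hfin : (2 : ENNReal) ^ 2 ^ n * ENNReal.ofReal (W.splitBhattacharyya n i) ≠ ⊤ :=
    ENNReal.mul_ne_top (ENNReal.pow_ne_top ENNReal.ofNat_ne_top) ENNReal.ofReal_ne_top
  have h3 := ENNReal.toReal_mono hfin h2
  rw [ENNReal.toReal_sum fun u _ => measure_ne_top _ _, ENNReal.toReal_mul, ENNReal.toReal_pow,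
    ENNReal.toReal_ofReal (show 0 ≤ W.splitBhattacharyya n i from bhattacharyya_nonneg _)] at h3
  simpa [Measure.real] using h3

lemma card_frozen_filter {n : ℕ} (A : Finset (Fin (2 ^ n))) (u : Fin (2 ^ n) → ZMod 2) :
    (Finset.univ.filter fun f : Fin (2 ^ n) → ZMod 2 => ∀ i ∉ A, u i = f i).card = 2 ^ A.card := by
  have : (Finset.univ.filter fun f : Fin (2 ^ n) → ZMod 2 => ∀ i ∉ A, u i = f i) =
      Fintype.piFinset fun i => if i ∈ A then Finset.univ else {u i} := by
    ext f
    simp only [Finset.mem_filter, Finset.mem_univ, true_and, Fintype.mem_piFinset]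
    refine forall_congr' fun i => ?_
    by_cases h : i ∈ A <;> simp [h, eq_comm]
  rw [this, Fintype.card_piFinset]
  simp [apply_ite Finset.card, ZMod.card]

lemma blockErrorProb_nonneg {n : ℕ} (c : PolarCode n) : 0 ≤ W.blockErrorProb c :=
  mul_nonneg (by positivity) (Finset.sum_nonneg fun _ _ => measureReal_nonneg)

/-- On average over the frozen values, the block error probability is at most the sum of the
Bhattacharyya parameters of the information indices; some choice of the frozen values is at least
as good as the average. -/
lemma exists_blockErrorProb_le {n : ℕ} (A : Finset (Fin (2 ^ n))) :
    ∃ f, W.blockErrorProb ⟨A, f⟩ ≤ ∑ i ∈ A, W.splitBhattacharyya n i := by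
  set g : (Fin (2 ^ n) → ZMod 2) → ℝ := fun u => ∑ i ∈ A,
    (W.blockLaw (Matrix.vecMul u (polarMatrix n))).real (W.errorEvent u i) with hg
  have h1 : ∀ f, W.blockErrorProb ⟨A, f⟩ ≤ 1 / 2 ^ A.card *
      ∑ u : Fin (2 ^ n) → ZMod 2, if ∀ i ∉ A, u i = f i then g u else 0 := by
    intro f
    rw [blockErrorProb, ← Finset.sum_filter]
    refine mul_le_mul_of_nonneg_left (Finset.sum_le_sum fun u hu => ?_) (by positivity)
    refine le_trans (measureReal_mono ?_ (measure_ne_top _ _)) (measureReal_biUnion_finset_le A _)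
    intro y hy
    by_contra hcon
    simp only [Set.mem_iUnion, not_exists] at hcon
    exact hy (W.scDecode_eq ⟨A, f⟩ (Finset.mem_filter.1 hu).2 hcon)
  -- the average runs over all words `f`, although only the values outside `A` matter
  have h2 : ∑ f : Fin (2 ^ n) → ZMod 2, W.blockErrorProb ⟨A, f⟩ ≤
      ∑ _f : Fin (2 ^ n) → ZMod 2, ∑ i ∈ A, W.splitBhattacharyya n i := by
    calc ∑ f, W.blockErrorProb ⟨A, f⟩
        ≤ ∑ f, 1 / 2 ^ A.card *
          ∑ u : Fin (2 ^ n) → ZMod 2, (if ∀ i ∉ A, u i = f i then g u else 0) :=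
          Finset.sum_le_sum fun f _ => h1 f
      _ = ∑ u, g u := by
          rw [← Finset.mul_sum, Finset.sum_comm]
          simp only [← Finset.sum_filter, Finset.sum_const, card_frozen_filter, nsmul_eq_mul,
            ← Finset.mul_sum]
          push_cast
          field_simp
      _ ≤ ∑ i ∈ A, 2 ^ 2 ^ n * W.splitBhattacharyya n i := by
          rw [hg, Finset.sum_comm]
          exact Finset.sum_le_sum fun i _ => W.sum_blockLaw_errorEvent_le i
      _ = ∑ _f : Fin (2 ^ n) → ZMod 2, ∑ i ∈ A, W.splitBhattacharyya n i := by
          rw [Finset.sum_const, ← Finset.mul_sum]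
          simp [ZMod.card]
  obtain ⟨f, -, hf⟩ := Finset.exists_le_of_sum_le Finset.univ_nonempty h2
  exact ⟨f, hf⟩

/-- If sufficiently many split channels have a Bhattacharyya parameter of at most `ε`, the union
bound applies to the code that uses them. -/
lemma bestBlockErrorProb_le {n : ℕ} {R ε : ℝ} (hε : 0 ≤ ε)
    (h : R ≤ bitAverage n fun w => if bhattacharyya (iteratedLaw W.initialLaw w) ≤ ε
      then 1 else 0) :
    W.bestBlockErrorProb n R ≤ 2 ^ n * ε := by
  set S := Finset.univ.filter fun i : Fin (2 ^ n) => W.splitBhattacharyya n i ≤ ε with hS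
  have hcard : (2 : ℝ) ^ n * R ≤ S.card := by
    have := sum_indexPath n fun w => if bhattacharyya (iteratedLaw W.initialLaw w) ≤ ε
      then 1 else 0
    rw [← Finset.sum_filter, Finset.sum_const, nsmul_eq_mul, mul_one] at this
    change (S.card : ℝ) = _ at this
    rw [this]
    gcongr
  obtain ⟨A, hAS, hA⟩ := Finset.exists_subset_card_eq (Nat.ceil_le.2 hcard)
  obtain ⟨f, hf⟩ := W.exists_blockErrorProb_le A
  have hbdd : BddBelow (Set.range fun c : {c : PolarCode n // c.infoSet.card =
      ⌈(2 : ℝ) ^ n * R⌉₊} => W.blockErrorProb c.1) :=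
    ⟨0, by rintro _ ⟨c, rfl⟩; exact W.blockErrorProb_nonneg c.1⟩
  refine (ciInf_le hbdd ⟨⟨A, f⟩, hA⟩).trans (hf.trans ?_)
  calc ∑ i ∈ A, W.splitBhattacharyya n i ≤ ∑ _i ∈ A, ε :=
        Finset.sum_le_sum fun i hi => (Finset.mem_filter.1 (hAS hi)).2
    _ = A.card * ε := by rw [Finset.sum_const, nsmul_eq_mul]
    _ ≤ 2 ^ n * ε := by
        gcongr
        exact_mod_cast (Finset.card_le_univ A).trans_eq (by simp)

lemma bestBlockErrorProb_nonneg (n : ℕ) (R : ℝ) : 0 ≤ W.bestBlockErrorProb n R :=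
  Real.iInf_nonneg fun c => W.blockErrorProb_nonneg c.1

end BinaryInputChannel

/-! ### The Gaussian tail function -/

lemma gaussianQ_eq (x : ℝ) :
    gaussianQ x = (ProbabilityTheory.gaussianReal 0 1).real (Set.Ioi x) := by
  rw [Measure.real, ProbabilityTheory.gaussianReal_apply_eq_integral _ one_ne_zero,
    ENNReal.toReal_ofReal (integral_nonneg fun y => ProbabilityTheory.gaussianPDFReal_nonneg _ _ _),
    gaussianQ]
  congr 1
  ext u
  simp [ProbabilityTheory.gaussianPDFReal, div_eq_inv_mul]

lemma gaussianQ_eq_Ici (x : ℝ) :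
    gaussianQ x = (ProbabilityTheory.gaussianReal 0 1).real (Set.Ici x) := by
  have := ProbabilityTheory.nullSingletonClass_gaussianReal (μ := 0) (v := 1) one_ne_zero
  rw [gaussianQ_eq]
  exact measureReal_congr Ioi_ae_eq_Ici

lemma gaussianQ_strictAnti : StrictAnti gaussianQ := by
  intro x y hxy
  have hpos : 0 < (ProbabilityTheory.gaussianReal 0 1).real (Set.Ioc x y) := by
    rw [measureReal_def]
    refine ENNReal.toReal_pos (fun h => ?_) (measure_ne_top _ _)
    have := ProbabilityTheory.gaussianReal_absolutelyContinuous' 0 one_ne_zero h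
    rw [Real.volume_Ioc, ENNReal.ofReal_eq_zero] at this
    linarith
  rw [gaussianQ_eq, gaussianQ_eq, ← Set.Ioc_union_Ioi_eq_Ioi hxy.le,
    measureReal_union Set.Ioc_disjoint_Ioi_same measurableSet_Ioi]
  linarith

lemma continuous_gaussianQ : Continuous gaussianQ := by
  have hint : Integrable fun u : ℝ => Real.exp (-u ^ 2 / 2) / √(2 * Real.pi) := by
    convert! ProbabilityTheory.integrable_gaussianPDFReal 0 1 using 1
    ext u
    simp [ProbabilityTheory.gaussianPDFReal, div_eq_inv_mul]
  have h : gaussianQ = fun x => gaussianQ 0 -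
      ∫ u in (0 : ℝ)..x, Real.exp (-u ^ 2 / 2) / √(2 * Real.pi) := by
    ext x
    have := intervalIntegral.integral_interval_add_Ioi
      (hint.integrableOn (s := Set.Ioi 0)) (hint.integrableOn (s := Set.Ioi x))
    rw [gaussianQ, gaussianQ]
    linarith
  rw [h]
  exact continuous_const.sub
    (intervalIntegral.continuous_primitive (fun a b => hint.intervalIntegrable) 0)

lemma exists_gaussianQ_eq {r : ℝ} (h0 : 0 < r) (h1 : r < 1) : ∃ x, gaussianQ x = r := by
  have hQ : ∀ x, gaussianQ x =
      1 - ProbabilityTheory.cdf (ProbabilityTheory.gaussianReal 0 1) x := by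
    intro x
    rw [gaussianQ_eq, ProbabilityTheory.cdf_eq_real, ← Set.compl_Iic,
      probReal_compl_eq_one_sub measurableSet_Iic]
  have hbot : Tendsto gaussianQ atBot (nhds 1) := by
    rw [funext hQ]
    simpa using (ProbabilityTheory.tendsto_cdf_atBot _).const_sub 1
  have htop : Tendsto gaussianQ atTop (nhds 0) := by
    rw [funext hQ]
    simpa using (ProbabilityTheory.tendsto_cdf_atTop _).const_sub 1
  obtain ⟨a, ha⟩ := (hbot.eventually (lt_mem_nhds h1)).exists
  obtain ⟨b, hb⟩ := (htop.eventually (gt_mem_nhds h0)).exists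
  exact mem_range_of_exists_le_of_exists_ge continuous_gaussianQ ⟨b, hb.le⟩ ⟨a, ha.le⟩

lemma lt_gaussianQ_of_lt_gaussianQInv {r t : ℝ} (h0 : 0 < r) (h1 : r < 1)
    (ht : t < gaussianQInv r) : r < gaussianQ t := by
  have h : gaussianQ (gaussianQInv r) = r := Function.invFun_eq (exists_gaussianQ_eq h0 h1)
  calc r = gaussianQ (gaussianQInv r) := h.symm
    _ < gaussianQ t := gaussianQ_strictAnti ht

/-! ### The block error probability -/

/-- A larger coefficient of `√n` in the exponent absorbs the number of summands `2 ^ n` in the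
union bound. -/
lemma isLittleO_two_pow_mul {t t' : ℝ} (h : t < t') :
    (fun n : ℕ => (2 : ℝ) ^ n * (2 : ℝ) ^ (-(2 : ℝ) ^ (((n : ℝ) + t' * √n) / 2))) =o[atTop]
      (fun n : ℕ => (2 : ℝ) ^ (-(2 : ℝ) ^ (((n : ℝ) + t * √n) / 2))) := by
  have hs : Tendsto (fun n : ℕ => √(n : ℝ)) atTop atTop :=
    Real.tendsto_sqrt_atTop.comp tendsto_natCast_atTop_atTop
  have hr : (1 : ℝ) < 2 ^ (1 / 4 : ℝ) := Real.one_lt_rpow one_lt_two (by norm_num)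
  have hexp : Tendsto (fun n : ℕ => ((2 : ℝ) ^ (1 / 4 : ℝ)) ^ n) atTop atTop :=
    tendsto_pow_atTop_atTop_of_one_lt hr
  have hlin : ∀ᶠ n : ℕ in atTop, (n : ℝ) ≤ 1 / 4 * ((2 : ℝ) ^ (1 / 4 : ℝ)) ^ n := by
    have := (isLittleO_coe_const_pow_of_one_lt (R := ℝ) hr).bound (show (0 : ℝ) < 1 / 4 by norm_num)
    filter_upwards [this] with n hn
    rwa [Real.norm_of_nonneg (by positivity), Real.norm_of_nonneg (by positivity)] at hn
  refine isLittleO_of_tendsto (fun n hn => absurd hn (by positivity)) ?_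
  have hbound : ∀ᶠ n : ℕ in atTop, (2 : ℝ) ^ n * (2 : ℝ) ^ (-(2 : ℝ) ^ (((n : ℝ) + t' * √n) / 2)) /
      (2 : ℝ) ^ (-(2 : ℝ) ^ (((n : ℝ) + t * √n) / 2)) ≤
      (2 : ℝ) ^ (-(1 / 4 * ((2 : ℝ) ^ (1 / 4 : ℝ)) ^ n)) := by
    filter_upwards [hlin, hs.eventually_ge_atTop (2 / (t' - t)),
      hs.eventually_ge_atTop (-2 * t')] with n h1 h2 h3
    rw [← Real.rpow_natCast 2 n, ← Real.rpow_add two_pos, ← Real.rpow_sub two_pos]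
    refine Real.rpow_le_rpow_of_exponent_le one_le_two ?_
    have hsq : √(n : ℝ) * √n = n := Real.mul_self_sqrt (Nat.cast_nonneg n)
    have h4 : (2 : ℝ) * 2 ^ (((n : ℝ) + t * √n) / 2) ≤ 2 ^ (((n : ℝ) + t' * √n) / 2) := by
      nth_rewrite 1 [← Real.rpow_one 2]
      rw [← Real.rpow_add two_pos]
      refine Real.rpow_le_rpow_of_exponent_le one_le_two ?_
      rw [div_le_iff₀ (sub_pos.2 h)] at h2
      linarith
    have h5 : ((2 : ℝ) ^ (1 / 4 : ℝ)) ^ n ≤ 2 ^ (((n : ℝ) + t' * √n) / 2) := by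
      rw [← Real.rpow_natCast, ← Real.rpow_mul two_pos.le]
      refine Real.rpow_le_rpow_of_exponent_le one_le_two ?_
      nlinarith [Real.sqrt_nonneg (n : ℝ)]
    linarith
  refine squeeze_zero' (Eventually.of_forall fun n => by positivity) hbound ?_
  have : Tendsto (fun x : ℝ => (2 : ℝ) ^ (-x)) atTop (nhds 0) := by
    exact (tendsto_rpow_atBot_of_base_gt_one 2 one_lt_two).comp tendsto_neg_atTop_atBot
  exact this.comp (hexp.const_mul_atTop (by norm_num))

end

theorem theorem1 {Y : Type*} [MeasurableSpace Y] (μ : Measure Y) [SigmaFinite μ]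
    (W : BinaryInputChannel Y μ) (hI : 0 < W.symmetricCapacity)
    (R : ℝ) (hR0 : 0 < R) (hRI : R < W.symmetricCapacity)
    (t : ℝ) (ht : t < gaussianQInv (R / W.symmetricCapacity)) :
    (fun n : ℕ => W.bestBlockErrorProb n R) =o[atTop]
      (fun n : ℕ => (2 : ℝ) ^ (-(2 : ℝ) ^ (((n : ℝ) + t * Real.sqrt n) / 2))) := by
  obtain ⟨t₂, ht₂, ht₂'⟩ := exists_between ht
  obtain ⟨t₁, ht₁, ht₁'⟩ := exists_between ht₂
  have hQ := lt_gaussianQ_of_lt_gaussianQInv (div_pos hR0 hI) ((div_lt_one hI).2 hRI) ht₂'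
  have hQ0 := (div_pos hR0 hI).trans hQ
  rw [div_lt_iff₀' hI] at hQ
  rw [gaussianQ_eq_Ici] at hQ hQ0
  rw [W.symmetricCapacity_eq] at hI hQ
  have hev := eventually_le_bitAverage W.initialLaw ht₁' hI hQ hQ0
  refine IsBigO.trans_isLittleO ?_ (isLittleO_two_pow_mul ht₁)
  refine IsBigO.of_bound 1 ?_
  filter_upwards [hev] with n hn
  rw [one_mul, Real.norm_of_nonneg (W.bestBlockErrorProb_nonneg n R),
    Real.norm_of_nonneg (by positivity)]
  exact W.bestBlockErrorProb_le (by positivity) hn
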